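/- Let $\mathbb D$ be the open unit disk and $H^\infty$ the algebra of bounded analytic functions on $\mathbb D$. For $\varphi,\psi\in H^\infty$ write $\varphi\mid\psi$ if $\psi=\varphi g$ for some $g\in H^\infty$, and $\varphi\equiv\psi$ if $\varphi=c\psi$ for a constant $c$ with $|c|=1$. For an inner function $\theta$ let the Jordan block $S(\theta)$ be the compression of the unilateral shift on the Hardy space $H^2$ to $\mathcal H(\theta)=H^2\ominus\theta H^2$. Identify a cardinal $\aleph$ with the least ordinal of its cardinality. A Jordan operator is an operator $\bigoplus_{1\le n<\aleph}S(\theta_n)$, indexed by ordinals $n$, where every $\theta_n$ is inner and $\theta_n\mid\theta_m$ whenever $\operatorname{card}(n)\ge\operatorname{card}(m)$. An operator $T$ on a complex Hilbert space is of class $C_0$ if it is a completely nonunitary contraction and $u(T)=0$ for some nonzero $u\in H^\infty$ (in the Sz.-Nagy--Foias functional calculus). Operators $T$ on $\mathcal H$ and $T_1$ on $\mathcal H_1$ are quasisimilar, written $T\sim T_1$, if there are bounded injective operators with dense range $X:\mathcal H\to\mathcal H_1$ and $Y:\mathcal H_1\to\mathcal H$ such that $XT=T_1X$ and $TY=YT_1$.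 **Proposition.** Let $\aleph$ be an infinite cardinal and let $$J=\bigoplus_{1\le n<\aleph}S(\theta_n),\qquad J'=\bigoplus_{1\le n<\aleph}S(\theta'_n),\qquad J''=\bigoplus_{1\le n<\aleph}S(\theta''_n)$$ be Jordan operators. Assume that 1. $\theta_n\equiv\theta_1$, $\theta'_n\equiv\theta'_1$ and $\theta''_n\equiv\theta''_1$ for all $1\le n<\aleph$ with $n\le\aleph_0$; 2. $\theta'_n\mid\theta_n$ and $\theta''_n\mid\theta_n$ for all $1\le n<\aleph$; 3. $\theta_n\mid\theta'_n\theta''_n$ for all $1\le n<\aleph$. Then there exist an operator $T$ of class $C_0$ on a complex Hilbert space $\mathcal H$ and a closed invariant subspace $\mathcal H'$ for $T$ such that $T\sim J$, $T|\mathcal H'\sim J'$, and $P_{\mathcal H'^\perp}T|\mathcal H'^\perp\sim J''$. -/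

import Mathlib

open Filter Topology
open scoped ENNReal

universe u

noncomputable section

namespace CZero

/-! ### Bounded analytic functions and inner functions

Functions on the unit disk are represented by functions `ℂ → ℂ`; only the values on the open unit
disk are ever used. -/

/-- `u` belongs to the algebra `H^∞` of bounded analytic functions in the unit disk. -/
def IsHInfty (u : ℂ → ℂ) : Prop :=
  DifferentiableOn ℂ u (Metric.ball 0 1) ∧ ∃ C : ℝ, ∀ z ∈ Metric.ball (0 : ℂ) 1, ‖u z‖ ≤ C

/-- `θ` is an inner function: it belongs to `H^∞` and at almost every point `e^{it}` of the unit
circle it has a radial limit of absolute value `1`. -/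
def IsInner (θ : ℂ → ℂ) : Prop :=
  IsHInfty θ ∧ ∀ᵐ t : ℝ, ∃ w : ℂ, ‖w‖ = 1 ∧
    Tendsto (fun r : ℝ => θ ((r : ℂ) * Complex.exp ((t : ℂ) * Complex.I))) (𝓝[<] 1) (𝓝 w)

/-- `φ` divides `ψ` in `H^∞`. -/
def Divides (φ ψ : ℂ → ℂ) : Prop :=
  ∃ g : ℂ → ℂ, IsHInfty g ∧ ∀ z ∈ Metric.ball (0 : ℂ) 1, ψ z = φ z * g z

/-- `φ ≡ ψ`: the functions agree on the disk up to a constant factor of absolute value `1`. -/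
def Equivalent (φ ψ : ℂ → ℂ) : Prop :=
  ∃ c : ℂ, ‖c‖ = 1 ∧ ∀ z ∈ Metric.ball (0 : ℂ) 1, φ z = c * ψ z

/-! ### The Hardy space and the unilateral shift -/

/-- The Hardy space `H²`: the analytic functions in the disk with square-summable Taylor
coefficients, with the `ℓ²` norm of the coefficients. An element is given by its sequence of
Taylor coefficients. -/
abbrev HardySpace : Type := lp (fun _ : ℕ => ℂ) 2

/-- The analytic function in the unit disk represented by an element of `H²`. -/
def HardySpace.toFun (f : HardySpace) (z : ℂ) : ℂ := ∑' n : ℕ, f n * z ^ n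

theorem HardySpace.summable (f : HardySpace) {z : ℂ} (hz : z ∈ Metric.ball (0 : ℂ) 1) :
    Summable fun n : ℕ => f n * z ^ n := by
  have hz' : ‖z‖ < 1 := by simpa using hz
  refine Summable.of_norm_bounded
    ((summable_geometric_of_lt_one (norm_nonneg z) hz').mul_left ‖f‖) fun n => ?_
  rw [norm_mul, norm_pow]
  exact mul_le_mul_of_nonneg_right (lp.norm_apply_le_norm (by norm_num) f n) (by positivity)

/-- The subspace `θ H²` of `H²`, consisting of the products `θ f` with `f ∈ H²`. -/
def innerMultiples (θ : ℂ → ℂ) : Submodule ℂ HardySpace where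
  carrier := {g | ∃ f : HardySpace, ∀ z ∈ Metric.ball (0 : ℂ) 1, g.toFun z = θ z * f.toFun z}
  zero_mem' := ⟨0, fun z _ => by simp [HardySpace.toFun]⟩
  add_mem' := by
    rintro a b ⟨f, hf⟩ ⟨g, hg⟩
    have key : ∀ (p q : HardySpace), ∀ z ∈ Metric.ball (0 : ℂ) 1,
        (p + q).toFun z = p.toFun z + q.toFun z := fun p q z hz => by
      simp only [HardySpace.toFun]
      rw [← (p.summable hz).tsum_add (q.summable hz)]
      exact tsum_congr fun n => by simp [add_mul]
    exact ⟨f + g, fun z hz => by rw [key _ _ z hz, key _ _ z hz, hf z hz, hg z hz]; ring⟩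
  smul_mem' := by
    rintro c a ⟨f, hf⟩
    have key : ∀ (p : HardySpace) (z : ℂ), (c • p).toFun z = c * p.toFun z := fun p z => by
      simp only [HardySpace.toFun]
      rw [← tsum_mul_left]
      exact tsum_congr fun n => by simp [mul_assoc]
    exact ⟨c • f, fun z hz => by rw [key, key, hf z hz]; ring⟩

/-- The sequence `(0, f 0, f 1, …)`. -/
def shiftSeq (f : ℕ → ℂ) : ℕ → ℂ
  | 0 => 0
  | n + 1 => f n

theorem hasSum_shiftSeq (f : HardySpace) :
    HasSum (fun n => ‖shiftSeq f n‖ ^ (2 : ℝ≥0∞).toReal) (‖f‖ ^ (2 : ℝ≥0∞).toReal) := by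
  have h := lp.hasSum_norm (p := 2) (by norm_num) f
  rw [← hasSum_nat_add_iff' 1]
  simpa [shiftSeq] using h

/-- The unilateral shift on `H²`, that is, multiplication by the variable. -/
def shift : HardySpace →L[ℂ] HardySpace :=
  LinearMap.mkContinuous
    { toFun := fun f => ⟨shiftSeq f, memℓp_gen (hasSum_shiftSeq f).summable⟩
      map_add' := fun f g => by
        ext n
        change shiftSeq (f + g : HardySpace) n = shiftSeq f n + shiftSeq g n
        cases n <;> simp [shiftSeq]
      map_smul' := fun c f => by ext n; cases n <;> simp [shiftSeq] } 1
    fun f => by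
      rw [one_mul]
      refine lp.norm_le_of_tsum_le (by norm_num) (norm_nonneg f) ?_
      exact (hasSum_shiftSeq f).tsum_eq.le

theorem norm_shift_le : ‖shift‖ ≤ 1 := LinearMap.mkContinuous_norm_le _ zero_le_one _

/-! ### Operators on Hilbert spaces -/

section Operators

variable {H : Type*} [NormedAddCommGroup H] [InnerProductSpace ℂ H]
variable {K : Type*} [NormedAddCommGroup K] [InnerProductSpace ℂ K]

/-- The compression `P_M T|M` of an operator to a subspace `M`. -/
def compression (M : Submodule ℂ H) [M.HasOrthogonalProjection] (T : H →L[ℂ] H) : M →L[ℂ] M :=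
  M.orthogonalProjectionOnto ∘L T ∘L M.subtypeL

/-- Quasisimilarity `T ∼ T'`: there are bounded injective intertwining operators with dense range
in both directions. -/
def QuasiSimilar (T : H →L[ℂ] H) (T' : K →L[ℂ] K) : Prop :=
  ∃ (X : H →L[ℂ] K) (Y : K →L[ℂ] H),
    Function.Injective X ∧ DenseRange X ∧ Function.Injective Y ∧ DenseRange Y ∧
    X ∘L T = T' ∘L X ∧ T ∘L Y = Y ∘L T'

/-- `T` is a completely nonunitary contraction: `‖T‖ ≤ 1` and there is no nonzero closed subspace
which `T` maps isometrically onto itself. -/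
def IsCNUContraction (T : H →L[ℂ] H) : Prop :=
  ‖T‖ ≤ 1 ∧ ∀ M : Submodule ℂ H, IsClosed (M : Set H) →
    M.map (T : H →ₗ[ℂ] H) = M → (∀ x ∈ M, ‖T x‖ = ‖x‖) → M = ⊥

/-- For `0 ≤ r < 1`, the operator `u(rT) = ∑ aₙ rⁿ Tⁿ`, where `aₙ` are the Taylor coefficients
of `u` at `0`. -/
def dilatedCalculus (u : ℂ → ℂ) (T : H →L[ℂ] H) (r : ℝ) : H →L[ℂ] H :=
  ∑' n : ℕ, (iteratedDeriv n u 0 / (n.factorial : ℂ) * (r : ℂ) ^ n) • T ^ n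

/-- `u(T) = A` in the Sz.-Nagy–Foias functional calculus: `A` is the strong limit of `u(rT)` as
`r` increases to `1`. -/
def FunctionalCalculusEq (u : ℂ → ℂ) (T A : H →L[ℂ] H) : Prop :=
  ∀ x : H, Tendsto (fun r : ℝ => dilatedCalculus u T r x) (𝓝[<] 1) (𝓝 (A x))

/-- `T` is an operator of class `C₀`: a completely nonunitary contraction with `u(T) = 0` for some
nonzero `u ∈ H^∞`. -/
def IsClassC0 (T : H →L[ℂ] H) : Prop :=
  IsCNUContraction T ∧ ∃ u : ℂ → ℂ, IsHInfty u ∧ (∃ z ∈ Metric.ball (0 : ℂ) 1, u z ≠ 0) ∧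
    FunctionalCalculusEq u T 0

end Operators

/-- The Hilbert space direct sum of a family of contractions, acting coordinatewise. -/
def directSum {ι : Type*} {E : ι → Type*} [∀ i, NormedAddCommGroup (E i)]
    [∀ i, InnerProductSpace ℂ (E i)] (T : ∀ i, E i →L[ℂ] E i) (hT : ∀ i, ‖T i‖ ≤ 1) :
    lp E 2 →L[ℂ] lp E 2 :=
  have hle : ∀ (f : lp E 2) (i : ι),
      ‖T i (f i)‖ ^ (2 : ℝ≥0∞).toReal ≤ ‖f i‖ ^ (2 : ℝ≥0∞).toReal := fun f i =>
    Real.rpow_le_rpow (norm_nonneg _)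
      (((T i).le_of_opNorm_le (hT i) (f i)).trans_eq (one_mul _)) (by norm_num)
  have hsum : ∀ f : lp E 2, Summable fun i => ‖f i‖ ^ (2 : ℝ≥0∞).toReal := fun f =>
    (lp.hasSum_norm (p := 2) (by norm_num) f).summable
  have hsum' : ∀ f : lp E 2, Summable fun i => ‖T i (f i)‖ ^ (2 : ℝ≥0∞).toReal := fun f =>
    Summable.of_nonneg_of_le (fun i => by positivity) (hle f) (hsum f)
  LinearMap.mkContinuous
    { toFun := fun f => ⟨fun i => T i (f i), memℓp_gen (hsum' f)⟩
      map_add' := fun f g => by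
        ext i
        exact map_add (T i) (f i) (g i)
      map_smul' := fun c f => by ext i; simp } 1
    fun f => by
      rw [one_mul]
      refine lp.norm_le_of_tsum_le (by norm_num) (norm_nonneg f) ?_
      rw [lp.norm_rpow_eq_tsum (p := 2) (by norm_num) f]
      exact (hsum' f).tsum_le_tsum (hle f) (hsum f)

/-! ### Jordan blocks and Jordan operators -/

/-- The space `ℋ(θ) = H² ⊖ θ H²`. -/
abbrev blockSpace (θ : ℂ → ℂ) : Submodule ℂ HardySpace := (innerMultiples θ)ᗮ

/-- The Jordan block `S(θ)`: the compression of the unilateral shift to `ℋ(θ)`. -/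
def jordanBlock (θ : ℂ → ℂ) : blockSpace θ →L[ℂ] blockSpace θ := compression (blockSpace θ) shift

theorem norm_jordanBlock_le (θ : ℂ → ℂ) : ‖jordanBlock θ‖ ≤ 1 := by
  refine ContinuousLinearMap.opNorm_le_bound _ zero_le_one fun x => ?_
  rw [one_mul]
  calc ‖jordanBlock θ x‖ ≤ ‖shift (x : HardySpace)‖ :=
        (blockSpace θ).norm_orthogonalProjectionOnto_apply_le _
    _ ≤ ‖(x : HardySpace)‖ := (shift.le_of_opNorm_le norm_shift_le _).trans_eq (one_mul _)

/-- The ordinals `n` with `1 ≤ n < ℵ`, the cardinal `ℵ` being identified with the least ordinal of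
its cardinality. -/
abbrev Index (κ : Cardinal.{u}) : Type (u + 1) := Set.Ico (1 : Ordinal.{u}) κ.ord

/-- The families `(θₙ)`, `1 ≤ n < ℵ`, that define Jordan operators: all `θₙ` are inner, and `θₙ`
divides `θₘ` whenever `card n ≥ card m`. -/
structure IsJordanFamily {κ : Cardinal.{u}} (θ : Index κ → ℂ → ℂ) : Prop where
  inner : ∀ n, IsInner (θ n)
  divides : ∀ m n : Index κ, m.1.card ≤ n.1.card → Divides (θ n) (θ m)

/-- The Hilbert space `⨁ ℋ(θₙ)`, `1 ≤ n < ℵ`. -/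
abbrev JordanSpace {κ : Cardinal.{u}} (θ : Index κ → ℂ → ℂ) : Type (u + 1) :=
  lp (fun n : Index κ => blockSpace (θ n)) 2

/-- The Jordan operator `⨁ S(θₙ)`, `1 ≤ n < ℵ`. -/
def jordanOperator {κ : Cardinal.{u}} (θ : Index κ → ℂ → ℂ) :
    JordanSpace θ →L[ℂ] JordanSpace θ :=
  directSum (fun n => jordanBlock (θ n)) fun n => norm_jordanBlock_le (θ n)

end CZero

end

/-!
The operator `T` is `⨁ S(θₙ) ⊕ S(θₙ)`. Put `α = θ / θ''` and `β = θ / θ'` (with the index `n`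
omitted); these are inner functions, and cancelling in `θ ∣ θ' θ''` gives `α ∣ θ'` and `β ∣ θ''`.
Whenever `θ = φ ψ`, the subspace `φ H² ⊖ θ H²` of `ℋ(θ)` is invariant for `S(θ)`, the restriction to
it is unitarily equivalent to `S(ψ)` through multiplication by `φ`, and the compression to its
complement `ℋ(φ)` is `S(φ)`. With `φ = β`, `ψ = θ'` in the first copy of `S(θ)` and `φ = θ''`,
`ψ = α` in the second one, this gives an invariant subspace on which `T` acts as
`⨁ S(θ'ₙ) ⊕ S(αₙ)`, with compression `⨁ S(βₙ) ⊕ S(θ''ₙ)`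
(`quasiSimilar_restrict_blockSum`, `quasiSimilar_compression_blockSum`).

The superfluous summands `S(αₙ)`, `S(βₙ)` and the second copies of `S(θₙ)` are then absorbed
(`quasiSimilar_blockSum_absorb`). By the first hypothesis, every function in a Jordan family of the
proposition is repeated infinitely often, so that the index set `I` can be identified with `I × ℕ`
compatibly with this repetition (`exists_equiv_prod_nat`). If a summand with operator `A` embeds
isometrically, by `V`, in a summand `S` that occurs infinitely often, then
`((fₖ)ₖ, g) ↦ (2⁻ᵏ (fₖ + V g))ₖ` maps `⨁ₖ S ⊕ A` to `⨁ₖ S` with dense range, and it is injective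
because the constant sequence of norms `‖V g‖` is square-summable only if `g = 0`. The adjoint of
such a map, built from an embedding that intertwines the adjoint operators, goes in the other
direction. For `φ ∣ θ` the two embeddings of `ℋ(φ)` in `ℋ(θ)` are multiplication by `θ / φ` and the
inclusion.

The analytic input is that bounded analytic functions act boundedly on `H²` by multiplication and
that inner functions act isometrically (`IsInner.norm_mulOp`); both follow from Parseval's identity
on circles of radius `r < 1`. That `T` is of class `C₀` follows from `θ₁(T) = 0`
(`tendsto_dilatedCalculus_jordanBlock`) and from the strong convergence `T*ⁿ → 0`
(`isCNUContraction_of_tendsto`).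
-/

noncomputable section

namespace CZero

/-! ### Square-summable families -/

section SquareSummable

variable {ι : Type*} {E : ι → Type*} [∀ i, NormedAddCommGroup (E i)]

theorem hasSum_norm_sq (f : lp E 2) : HasSum (fun i => ‖f i‖ ^ 2) (‖f‖ ^ 2) := by
  simpa using lp.hasSum_norm (p := 2) (by norm_num) f

theorem memℓp_two_of_summable {f : ∀ i, E i} (h : Summable fun i => ‖f i‖ ^ 2) : Memℓp f 2 :=
  memℓp_gen (by simpa using h)

/-- Dominated convergence for square-summable families. -/
theorem tendsto_zero_of_dominated {α : Type*} {l : Filter α} {F : α → lp E 2}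
    {b : ι → ℝ} (hb : Summable b) (hle : ∀ᶠ a in l, ∀ i, ‖F a i‖ ^ 2 ≤ b i)
    (hlim : ∀ i, Tendsto (fun a => F a i) l (𝓝 0)) : Tendsto F l (𝓝 0) := by
  have h : Tendsto (fun a => ∑' i, ‖F a i‖ ^ 2) l (𝓝 (∑' _ : ι, (0 : ℝ))) := by
    refine tendsto_tsum_of_dominated_convergence hb (fun i => ?_) ?_
    · simpa using ((hlim i).norm).pow 2
    · filter_upwards [hle] with a ha i
      simpa using ha i
  simp only [(hasSum_norm_sq _).tsum_eq, tsum_zero] at h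
  rw [tendsto_zero_iff_norm_tendsto_zero]
  simpa using h.sqrt

end SquareSummable

/-! ### Analytic functions and Parseval's identity -/

section Parseval

theorem summable_sq_of_summable_norm {b : ℕ → ℂ} (hb : Summable fun n => ‖b n‖) :
    Summable fun n => ‖b n‖ ^ 2 := by
  refine Summable.of_nonneg_of_le (fun n => by positivity) (fun n => ?_)
    (hb.mul_left (∑' m, ‖b m‖))
  rw [sq]
  exact mul_le_mul_of_nonneg_right (hb.le_tsum n fun _ _ => norm_nonneg _) (norm_nonneg _)

theorem norm_circleMap_one (t : ℝ) : ‖circleMap 0 1 t‖ = 1 := by simp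

theorem continuous_tsum_circleMap {b : ℕ → ℂ} (hb : Summable fun n => ‖b n‖) :
    Continuous fun t : ℝ => ∑' n, b n * circleMap 0 1 t ^ n :=
  continuous_tsum (fun n => by fun_prop) hb fun n t => by simp

/-- Parseval's identity for an absolutely convergent power series on the unit circle. -/
theorem circleAverage_norm_sq_tsum {b : ℕ → ℂ} (hb : Summable fun n => ‖b n‖) :
    Real.circleAverage (fun z => ‖∑' n, b n * z ^ n‖ ^ 2) 0 1 = ∑' n, ‖b n‖ ^ 2 := by
  have hsum : ∀ z : ℂ, ‖z‖ = 1 → Summable fun n => b n * z ^ n := fun z hz =>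
    Summable.of_norm (by simpa [hz] using hb)
  have hpoly : ∀ N : ℕ, Real.circleAverage (fun z => ‖∑ n ∈ Finset.range N, b n * z ^ n‖ ^ 2) 0 1 =
      ∑ n ∈ Finset.range N, ‖b n‖ ^ 2 := by
    intro N
    have h := (∑ n ∈ Finset.range N, Polynomial.monomial n (b n)).sum_sq_norm_coeff_eq_circleAverage
    simp only [Polynomial.eval_finsetSum, Polynomial.eval_monomial] at h
    rw [← h]
    have hc : ∀ i, (∑ n ∈ Finset.range N, Polynomial.monomial n (b n)).coeff i =
        if i < N then b i else 0 := fun i => by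
      simp [Polynomial.finsetSum_coeff, Polynomial.coeff_monomial]
    rw [Finset.sum_subset (s₂ := Finset.range N)]
    · exact Finset.sum_congr rfl fun i hi => by rw [hc, if_pos (Finset.mem_range.1 hi)]
    · intro i hi
      rw [Polynomial.mem_support_iff, hc] at hi
      exact Finset.mem_range.2 (by by_contra h; simp [h] at hi)
    · intro i _ hi
      rw [Polynomial.notMem_support_iff.1 hi]
      simp
  refine tendsto_nhds_unique (f := fun N : ℕ => ∑ n ∈ Finset.range N, ‖b n‖ ^ 2) ?_
    (summable_sq_of_summable_norm hb).hasSum.tendsto_sum_nat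
  simp only [← hpoly, Real.circleAverage_def]
  refine Tendsto.const_smul ?_ _
  refine intervalIntegral.tendsto_integral_filter_of_dominated_convergence
    (fun _ => (∑' n, ‖b n‖) ^ 2) (Eventually.of_forall fun N => ?_)
    (Eventually.of_forall fun N => Eventually.of_forall fun t _ => ?_) (by simp)
    (Eventually.of_forall fun t _ => ?_)
  · exact Continuous.aestronglyMeasurable (by fun_prop)
  · rw [norm_pow, norm_norm]
    gcongr
    refine (norm_sum_le _ _).trans ?_
    simpa using hb.sum_le_tsum (Finset.range N) fun _ _ => norm_nonneg _
  · exact ((hsum _ (norm_circleMap_one t)).hasSum.tendsto_sum_nat.norm).pow 2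

theorem circleIntegrable_norm_sq_tsum {b : ℕ → ℂ} (hb : Summable fun n => ‖b n‖) :
    CircleIntegrable (fun z => ‖∑' n, b n * z ^ n‖ ^ 2) 0 1 :=
  Continuous.intervalIntegrable ((continuous_tsum_circleMap hb).norm.pow 2) _ _

theorem ofReal_mul_mem_ball {r : ℝ} (h0 : 0 ≤ r) (h1 : r < 1) {z : ℂ} (hz : ‖z‖ ≤ 1) :
    (r : ℂ) * z ∈ Metric.ball (0 : ℂ) 1 := by
  rw [mem_ball_zero_iff, norm_mul, Complex.norm_real, Real.norm_of_nonneg h0]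
  nlinarith

/-- The Taylor coefficients of `h` at `0`. -/
def taylorCoeff (h : ℂ → ℂ) (n : ℕ) : ℂ := iteratedDeriv n h 0 / (n.factorial : ℂ)

theorem hasSum_taylorCoeff {h : ℂ → ℂ} (hd : DifferentiableOn ℂ h (Metric.ball 0 1)) {z : ℂ}
    (hz : z ∈ Metric.ball (0 : ℂ) 1) : HasSum (fun n => taylorCoeff h n * z ^ n) (h z) := by
  have := Complex.hasSum_taylorSeries_on_ball hd hz
  simp only [smul_eq_mul, sub_zero] at this
  have e : (fun n => taylorCoeff h n * z ^ n) =
      fun n : ℕ => (n.factorial : ℂ)⁻¹ * (z ^ n * iteratedDeriv n h 0) := by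
    funext n
    rw [taylorCoeff]
    ring
  rwa [e]

theorem summable_norm_taylorCoeff {h : ℂ → ℂ} (hd : DifferentiableOn ℂ h (Metric.ball 0 1)) {r : ℝ}
    (h0 : 0 ≤ r) (h1 : r < 1) : Summable fun n => ‖taylorCoeff h n * (r : ℂ) ^ n‖ :=
  (hasSum_taylorCoeff hd
    (by simpa using ofReal_mul_mem_ball h0 h1 (z := 1) (by simp))).summable.norm

theorem tsum_taylorCoeff_mul {h : ℂ → ℂ} (hd : DifferentiableOn ℂ h (Metric.ball 0 1)) {r : ℝ}
    (h0 : 0 ≤ r) (h1 : r < 1) {z : ℂ} (hz : ‖z‖ ≤ 1) :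
    ∑' n, taylorCoeff h n * (r : ℂ) ^ n * z ^ n = h (r * z) := by
  rw [← (hasSum_taylorCoeff hd (ofReal_mul_mem_ball h0 h1 hz)).tsum_eq]
  exact tsum_congr fun n => by rw [mul_pow]; ring

end Parseval

/-! ### The Hardy space as a space of functions -/

namespace HardySpace

theorem toFun_add (f g : HardySpace) {z : ℂ} (hz : z ∈ Metric.ball (0 : ℂ) 1) :
    (f + g).toFun z = f.toFun z + g.toFun z := by
  simp only [toFun]
  rw [← (f.summable hz).tsum_add (g.summable hz)]
  exact tsum_congr fun n => by simp [add_mul]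

theorem toFun_smul (c : ℂ) (f : HardySpace) (z : ℂ) : (c • f).toFun z = c * f.toFun z := by
  simp only [toFun]
  rw [← tsum_mul_left]
  exact tsum_congr fun n => by simp [mul_assoc]

theorem toFun_sub (f g : HardySpace) {z : ℂ} (hz : z ∈ Metric.ball (0 : ℂ) 1) :
    (f - g).toFun z = f.toFun z - g.toFun z := by
  have h := toFun_add (f - g) g hz
  rw [sub_add_cancel] at h
  rw [h, add_sub_cancel_right]

/-- Evaluation at a point of the disk, as a bounded functional on `H²`. -/
def evalAt (z : ℂ) (hz : z ∈ Metric.ball (0 : ℂ) 1) : HardySpace →L[ℂ] ℂ :=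
  LinearMap.mkContinuous
    { toFun := fun f => f.toFun z
      map_add' := fun f g => toFun_add f g hz
      map_smul' := fun c f => toFun_smul c f z } (∑' n : ℕ, ‖z‖ ^ n) fun f => by
    have hz' : ‖z‖ < 1 := by simpa using hz
    have hs := (summable_geometric_of_lt_one (norm_nonneg z) hz').mul_right ‖f‖
    rw [← tsum_mul_right]
    refine tsum_of_norm_bounded hs.hasSum fun n => ?_
    rw [norm_mul, norm_pow, mul_comm]
    exact mul_le_mul_of_nonneg_left (lp.norm_apply_le_norm (by norm_num) f n) (by positivity)

theorem evalAt_apply (z : ℂ) (hz : z ∈ Metric.ball (0 : ℂ) 1) (f : HardySpace) :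
    evalAt z hz f = f.toFun z := rfl

theorem differentiableOn_toFun (f : HardySpace) :
    DifferentiableOn ℂ f.toFun (Metric.ball 0 1) := by
  intro z hz
  obtain ⟨r, hzr, hr⟩ := exists_between (show ‖z‖ < 1 by simpa using hz)
  have hr0 : 0 ≤ r := (norm_nonneg z).trans hzr.le
  have h : DifferentiableOn ℂ f.toFun (Metric.ball 0 r) := by
    refine Complex.differentiableOn_tsum_of_summable_norm
      ((summable_geometric_of_lt_one hr0 hr).mul_left ‖f‖) (fun n => by fun_prop)
      Metric.isOpen_ball fun n w hw => ?_
    have hw' : ‖w‖ ≤ r := by simpa using (Metric.mem_ball.1 hw).le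
    rw [norm_mul, norm_pow]
    have := lp.norm_apply_le_norm (by norm_num) f n
    gcongr
  exact (h.differentiableAt
    (Metric.isOpen_ball.mem_nhds (by simpa using hzr))).differentiableWithinAt

theorem summable_norm_mul_pow (f : HardySpace) {r : ℝ} (h0 : 0 ≤ r) (h1 : r < 1) :
    Summable fun n => ‖f n * (r : ℂ) ^ n‖ :=
  (f.summable (by simpa using ofReal_mul_mem_ball h0 h1 (z := 1) (by simp))).norm

theorem tsum_mul_pow (f : HardySpace) (r : ℝ) (z : ℂ) :
    ∑' n, f n * (r : ℂ) ^ n * z ^ n = f.toFun (r * z) :=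
  tsum_congr fun n => by rw [mul_pow]; ring

theorem circleAverage_norm_sq (f : HardySpace) {r : ℝ} (h0 : 0 ≤ r) (h1 : r < 1) :
    Real.circleAverage (fun z => ‖f.toFun (r * z)‖ ^ 2) 0 1 = ∑' n, ‖f n * (r : ℂ) ^ n‖ ^ 2 := by
  simp only [← circleAverage_norm_sq_tsum (f.summable_norm_mul_pow h0 h1), tsum_mul_pow]

theorem tsum_norm_sq_mul_pow_le (f : HardySpace) {r : ℝ} (h0 : 0 ≤ r) (h1 : r < 1) :
    ∑' n, ‖f n * (r : ℂ) ^ n‖ ^ 2 ≤ ‖f‖ ^ 2 := by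
  rw [← (hasSum_norm_sq f).tsum_eq]
  refine Summable.tsum_le_tsum (fun n => ?_)
    (summable_sq_of_summable_norm (f.summable_norm_mul_pow h0 h1)) (hasSum_norm_sq f).summable
  have : ‖(r : ℂ) ^ n‖ ≤ 1 := by
    rw [norm_pow, Complex.norm_real, Real.norm_of_nonneg h0]
    exact pow_le_one₀ h0 h1.le
  gcongr
  rw [norm_mul]
  exact mul_le_of_le_one_right (norm_nonneg _) this

/-- An element of `H²` is determined by its values in the disk. -/
theorem ext_toFun {f g : HardySpace} (h : ∀ z ∈ Metric.ball (0 : ℂ) 1, f.toFun z = g.toFun z) :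
    f = g := by
  have h2 : (0 : ℝ) ≤ 1 / 2 := by norm_num
  have h2' : (1 / 2 : ℝ) < 1 := by norm_num
  have key := circleAverage_norm_sq (f - g) h2 h2'
  have h0 : Real.circleAverage
      (fun z => ‖(f - g).toFun (((1 / 2 : ℝ) : ℂ) * z)‖ ^ 2) 0 1 = 0 := by
    rw [Real.circleAverage_def]
    have : ∀ t : ℝ, ‖(f - g).toFun (((1 / 2 : ℝ) : ℂ) * circleMap 0 1 t)‖ ^ 2 = 0 := fun t => by
      have hm := ofReal_mul_mem_ball h2 h2' (norm_circleMap_one t).le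
      rw [toFun_sub _ _ hm, h _ hm]
      simp
    simp only [this]
    simp
  rw [h0] at key
  have hs := summable_sq_of_summable_norm ((f - g).summable_norm_mul_pow h2 h2')
  have hz := (hasSum_zero_iff_of_nonneg fun n => by positivity).1 (key ▸ hs.hasSum)
  refine sub_eq_zero.1 (lp.ext (funext fun n => ?_))
  have := congrFun hz n
  simpa using this

/-- An analytic function dominated in the disk by a multiple of an element of `H²` belongs to
`H²`. -/
theorem exists_toFun_eq {h : ℂ → ℂ} (hd : DifferentiableOn ℂ h (Metric.ball 0 1)) {C : ℝ}
    (hC : 0 ≤ C) (f : HardySpace)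
    (hle : ∀ z ∈ Metric.ball (0 : ℂ) 1, ‖h z‖ ≤ C * ‖f.toFun z‖) :
    ∃ F : HardySpace, (∀ z ∈ Metric.ball (0 : ℂ) 1, F.toFun z = h z) ∧ ‖F‖ ≤ C * ‖f‖ := by
  have hr : ∀ r : ℝ, 0 ≤ r → r < 1 → ∀ s : Finset ℕ,
      ∑ n ∈ s, ‖taylorCoeff h n * (r : ℂ) ^ n‖ ^ 2 ≤ (C * ‖f‖) ^ 2 := by
    intro r h0 h1 s
    have ha := summable_norm_taylorCoeff hd h0 h1
    calc ∑ n ∈ s, ‖taylorCoeff h n * (r : ℂ) ^ n‖ ^ 2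
        ≤ ∑' n, ‖taylorCoeff h n * (r : ℂ) ^ n‖ ^ 2 :=
          (summable_sq_of_summable_norm ha).sum_le_tsum s fun _ _ => by positivity
      _ ≤ C ^ 2 * ∑' n, ‖f n * (r : ℂ) ^ n‖ ^ 2 := by
          rw [← circleAverage_norm_sq_tsum ha,
            ← circleAverage_norm_sq_tsum (f.summable_norm_mul_pow h0 h1), ← smul_eq_mul,
            ← Real.circleAverage_fun_smul]
          refine Real.circleAverage_mono (circleIntegrable_norm_sq_tsum ha)
            (CircleIntegrable.const_smul
              (circleIntegrable_norm_sq_tsum (f.summable_norm_mul_pow h0 h1))) fun z hz => ?_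
          have hz' : ‖z‖ ≤ 1 := by simpa using (mem_sphere_zero_iff_norm.1 hz).le
          rw [tsum_taylorCoeff_mul hd h0 h1 hz', tsum_mul_pow, smul_eq_mul, ← mul_pow]
          gcongr
          exact hle _ (ofReal_mul_mem_ball h0 h1 hz')
      _ ≤ (C * ‖f‖) ^ 2 := by
          rw [mul_pow]
          gcongr
          exact f.tsum_norm_sq_mul_pow_le h0 h1
  have hfin : ∀ s : Finset ℕ, ∑ n ∈ s, ‖taylorCoeff h n‖ ^ 2 ≤ (C * ‖f‖) ^ 2 := by
    intro s
    have hcont : Continuous fun r : ℝ => ∑ n ∈ s, ‖taylorCoeff h n * (r : ℂ) ^ n‖ ^ 2 := by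
      fun_prop
    have hlim := (hcont.tendsto 1).mono_left (nhdsWithin_le_nhds (s := Set.Iio 1))
    simp only [Complex.ofReal_one, one_pow, mul_one] at hlim
    refine le_of_tendsto hlim ?_
    filter_upwards [Ioo_mem_nhdsLT (show (0 : ℝ) < 1 by norm_num)] with r hr'
    exact hr r hr'.1.le hr'.2 s
  have hsum : Summable fun n => ‖taylorCoeff h n‖ ^ 2 :=
    summable_of_sum_le (fun _ => by positivity) hfin
  refine ⟨⟨taylorCoeff h, memℓp_two_of_summable hsum⟩, fun z hz => ?_, ?_⟩
  · exact (hasSum_taylorCoeff hd hz).tsum_eq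
  · refine lp.norm_le_of_forall_sum_le (by norm_num) (by positivity) fun s => ?_
    simpa using hfin s

end HardySpace

/-! ### Multiplication operators on the Hardy space -/

open HardySpace

theorem IsHInfty.exists_mul {g : ℂ → ℂ} (hg : DifferentiableOn ℂ g (Metric.ball 0 1)) {C : ℝ}
    (hC : ∀ z ∈ Metric.ball (0 : ℂ) 1, ‖g z‖ ≤ C) (f : HardySpace) :
    ∃ F : HardySpace, (∀ z ∈ Metric.ball (0 : ℂ) 1, F.toFun z = g z * f.toFun z) ∧
      ‖F‖ ≤ C * ‖f‖ :=
  exists_toFun_eq (hg.mul f.differentiableOn_toFun)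
    ((norm_nonneg _).trans (hC 0 (by simp))) f fun z hz => by
      rw [Pi.mul_apply, norm_mul]
      exact mul_le_mul_of_nonneg_right (hC z hz) (norm_nonneg _)

theorem IsHInfty.exists_mulOp {g : ℂ → ℂ} (hg : IsHInfty g) :
    ∃ A : HardySpace →L[ℂ] HardySpace, ∀ f, ∀ z ∈ Metric.ball (0 : ℂ) 1,
      (A f).toFun z = g z * f.toFun z := by
  obtain ⟨hd, C, hC⟩ := hg
  choose F hF hFC using IsHInfty.exists_mul hd hC
  refine ⟨LinearMap.mkContinuous
    { toFun := F
      map_add' := fun f g => ext_toFun fun z hz => ?_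
      map_smul' := fun c f => ext_toFun fun z hz => ?_ } C hFC, hF⟩
  · rw [toFun_add _ _ hz, hF _ z hz, hF _ z hz, hF _ z hz, toFun_add _ _ hz, mul_add]
  · rw [hF _ z hz, toFun_smul, RingHom.id_apply, toFun_smul, hF _ z hz, mul_left_comm]

/-- Multiplication by a bounded analytic function, as an operator on `H²`. -/
def mulOp (g : ℂ → ℂ) (hg : IsHInfty g) : HardySpace →L[ℂ] HardySpace :=
  hg.exists_mulOp.choose

theorem mulOp_toFun {g : ℂ → ℂ} (hg : IsHInfty g) (f : HardySpace) {z : ℂ}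
    (hz : z ∈ Metric.ball (0 : ℂ) 1) : (mulOp g hg f).toFun z = g z * f.toFun z :=
  hg.exists_mulOp.choose_spec f z hz

theorem shift_toFun (f : HardySpace) {z : ℂ} (hz : z ∈ Metric.ball (0 : ℂ) 1) :
    (shift f).toFun z = z * f.toFun z := by
  have h0 : shift f 0 = 0 := rfl
  have h1 : ∀ n, shift f (n + 1) = f n := fun _ => rfl
  simp only [toFun]
  rw [((shift f).summable hz).tsum_eq_zero_add, ← tsum_mul_left]
  simp only [h0, h1, zero_mul, zero_add]
  exact tsum_congr fun n => by ring

theorem shift_mulOp {g : ℂ → ℂ} (hg : IsHInfty g) (f : HardySpace) :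
    shift (mulOp g hg f) = mulOp g hg (shift f) :=
  ext_toFun fun z hz => by
    rw [shift_toFun _ hz, mulOp_toFun hg _ hz, mulOp_toFun hg _ hz, shift_toFun _ hz, mul_left_comm]

theorem mem_innerMultiples_iff {θ : ℂ → ℂ} (hθ : IsHInfty θ) {g : HardySpace} :
    g ∈ innerMultiples θ ↔ ∃ f, mulOp θ hθ f = g :=
  ⟨fun ⟨f, hf⟩ => ⟨f, ext_toFun fun z hz => by rw [mulOp_toFun hθ _ hz, hf z hz]⟩,
    fun ⟨f, hf⟩ => ⟨f, fun z hz => by rw [← hf, mulOp_toFun hθ _ hz]⟩⟩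

theorem mulOp_mem_innerMultiples {θ : ℂ → ℂ} (hθ : IsHInfty θ) (f : HardySpace) :
    mulOp θ hθ f ∈ innerMultiples θ := (mem_innerMultiples_iff hθ).2 ⟨f, rfl⟩

theorem shift_mem_innerMultiples {θ : ℂ → ℂ} {g : HardySpace}
    (hg : g ∈ innerMultiples θ) : shift g ∈ innerMultiples θ := by
  obtain ⟨f, hf⟩ := hg
  exact ⟨shift f, fun z hz => by rw [shift_toFun _ hz, shift_toFun _ hz, hf z hz, mul_left_comm]⟩

/-- The limit of the integral means of an element of `H²` is its squared norm. -/
theorem tendsto_tsum_norm_sq (f : HardySpace) :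
    Tendsto (fun r : ℝ => ∑' n, ‖f n * (r : ℂ) ^ n‖ ^ 2) (𝓝[<] 1) (𝓝 (‖f‖ ^ 2)) := by
  rw [← (hasSum_norm_sq f).tsum_eq]
  refine tendsto_tsum_of_dominated_convergence (hasSum_norm_sq f).summable (fun n => ?_) ?_
  · have hcont : Continuous fun r : ℝ => ‖f n * (r : ℂ) ^ n‖ ^ 2 := by fun_prop
    simpa using (hcont.tendsto 1).mono_left (nhdsWithin_le_nhds (s := Set.Iio 1))
  · filter_upwards [Ioo_mem_nhdsLT (show (0 : ℝ) < 1 by norm_num)] with r hr n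
    rw [norm_pow, norm_norm, norm_mul]
    have : ‖(r : ℂ) ^ n‖ ≤ 1 := by
      rw [norm_pow, Complex.norm_real, Real.norm_of_nonneg hr.1.le]
      exact pow_le_one₀ hr.1.le hr.2.le
    gcongr
    exact mul_le_of_le_one_right (norm_nonneg _) this

/-- The dilations `f(rz)` of an element `f` of `H²` converge to `f` as `r` increases to `1`. -/
theorem exists_dilation (f : HardySpace) :
    ∃ D : ℝ → HardySpace, (∀ r : ℝ, 0 ≤ r → r < 1 → ∀ z, (D r).toFun z = f.toFun (r * z)) ∧
      Tendsto D (𝓝[<] 1) (𝓝 f) := by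
  have hle : ∀ r : ℝ, 0 ≤ r → r < 1 → ∀ n : ℕ, ‖(r : ℂ) ^ n‖ ≤ 1 := fun r h0 h1 n => by
    rw [norm_pow, Complex.norm_real, Real.norm_of_nonneg h0]
    exact pow_le_one₀ h0 h1.le
  have hD : ∀ r : ℝ, ∃ g : HardySpace, 0 ≤ r → r < 1 → ∀ n, g n = f n * (r : ℂ) ^ n := by
    intro r
    by_cases h : 0 ≤ r ∧ r < 1
    · exact ⟨⟨fun n => f n * (r : ℂ) ^ n, memℓp_two_of_summable
        (summable_sq_of_summable_norm (f.summable_norm_mul_pow h.1 h.2))⟩, fun _ _ _ => rfl⟩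
    · exact ⟨0, fun h0 h1 => absurd ⟨h0, h1⟩ h⟩
  choose D hD using hD
  refine ⟨D, fun r h0 h1 z => ?_, ?_⟩
  · rw [← tsum_mul_pow]
    exact tsum_congr fun n => by rw [hD r h0 h1]
  · rw [← tendsto_sub_nhds_zero_iff]
    have hI := Ioo_mem_nhdsLT (show (0 : ℝ) < 1 by norm_num)
    refine tendsto_zero_of_dominated ((hasSum_norm_sq f).summable.mul_left 4) ?_ fun n => ?_
    · filter_upwards [hI] with r hr n
      have h1 : ‖(D r - f) n‖ ≤ 2 * ‖f n‖ := by
        rw [lp.coeFn_sub, Pi.sub_apply, hD r hr.1.le hr.2, two_mul]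
        refine (norm_sub_le _ _).trans (add_le_add_left ?_ _)
        rw [norm_mul]
        exact mul_le_of_le_one_right (norm_nonneg _) (hle r hr.1.le hr.2 n)
      calc ‖(D r - f) n‖ ^ 2 ≤ (2 * ‖f n‖) ^ 2 := by gcongr
        _ = 4 * ‖f n‖ ^ 2 := by ring
    · have hcont : Continuous fun r : ℝ => f n * (r : ℂ) ^ n - f n := by fun_prop
      have := (hcont.tendsto 1).mono_left (nhdsWithin_le_nhds (s := Set.Iio 1))
      simp only [Complex.ofReal_one, one_pow, mul_one, sub_self] at this
      refine this.congr' ?_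
      filter_upwards [hI] with r hr
      rw [lp.coeFn_sub, Pi.sub_apply, hD r hr.1.le hr.2]

/-! ### Inner functions -/

theorem radial_mem_ball {r : ℝ} (hr : r ∈ Set.Ioo (0 : ℝ) 1) (t : ℝ) :
    (r : ℂ) * Complex.exp ((t : ℂ) * Complex.I) ∈ Metric.ball (0 : ℂ) 1 :=
  ofReal_mul_mem_ball hr.1.le hr.2 (Complex.norm_exp_ofReal_mul_I t).le

/-- Multiplication by an inner function preserves the norm of a polynomial: the integral means of
`θ p` converge to those of `p` on the unit circle. -/
theorem IsInner.norm_mulOp_of_finite {θ : ℂ → ℂ} (hθ : IsInner θ) (p : HardySpace) (s : Finset ℕ)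
    (hp : ∀ n ∉ s, p n = 0) : ‖mulOp θ hθ.1 p‖ = ‖p‖ := by
  have hpf : p.toFun = fun w => ∑ n ∈ s, p n * w ^ n := by
    funext w
    exact tsum_eq_sum fun n hn => by rw [hp n hn, zero_mul]
  have hpc : Continuous p.toFun := by
    rw [hpf]
    fun_prop
  have hps : Summable fun n => ‖p n‖ :=
    summable_of_ne_finset_zero (s := s) fun n hn => by rw [hp n hn, norm_zero]
  obtain ⟨C, hC⟩ := hθ.1.2
  set F := mulOp θ hθ.1 p with hF
  have hI := Ioo_mem_nhdsLT (show (0 : ℝ) < 1 by norm_num)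
  have hlim : Tendsto (fun r : ℝ => Real.circleAverage (fun z => ‖F.toFun (r * z)‖ ^ 2) 0 1)
      (𝓝[<] 1) (𝓝 (Real.circleAverage (fun z => ‖p.toFun z‖ ^ 2) 0 1)) := by
    simp only [Real.circleAverage_def]
    refine Tendsto.const_smul ?_ _
    refine intervalIntegral.tendsto_integral_filter_of_dominated_convergence
      (fun _ => (C * ∑' n, ‖p n‖) ^ 2) ?_ ?_ (by simp) ?_
    · filter_upwards [hI] with r hr
      refine Continuous.aestronglyMeasurable ?_
      refine (Continuous.norm ?_).pow 2
      exact F.differentiableOn_toFun.continuousOn.comp_continuous (by fun_prop) fun t =>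
        ofReal_mul_mem_ball hr.1.le hr.2 (norm_circleMap_one t).le
    · filter_upwards [hI] with r hr
      refine Eventually.of_forall fun t _ => ?_
      have hm := ofReal_mul_mem_ball hr.1.le hr.2 (norm_circleMap_one t).le
      rw [norm_pow, norm_norm, hF, mulOp_toFun hθ.1 _ hm, norm_mul]
      have h1 := hC _ hm
      have h2 : ‖p.toFun (r * circleMap 0 1 t)‖ ≤ ∑' n, ‖p n‖ := by
        refine tsum_of_norm_bounded hps.hasSum fun n => ?_
        rw [norm_mul, norm_pow]
        exact mul_le_of_le_one_right (norm_nonneg _)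
          (pow_le_one₀ (norm_nonneg _) (by simpa using (mem_ball_zero_iff.1 hm).le))
      have h3 : 0 ≤ C := (norm_nonneg _).trans h1
      gcongr
    · filter_upwards [hθ.2] with t ht _
      obtain ⟨w, hw, hwt⟩ := ht
      have h1 : Tendsto (fun r : ℝ => p.toFun (r * circleMap 0 1 t)) (𝓝[<] 1)
          (𝓝 (p.toFun (circleMap 0 1 t))) := by
        have hc : Continuous fun r : ℝ => p.toFun (r * circleMap 0 1 t) := by fun_prop
        simpa using (hc.tendsto 1).mono_left (nhdsWithin_le_nhds (s := Set.Iio 1))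
      have h2 : Tendsto (fun r : ℝ => θ (r * circleMap 0 1 t)) (𝓝[<] 1) (𝓝 w) := by
        simpa [circleMap] using hwt
      have h3 := ((h2.mul h1).norm).pow 2
      rw [norm_mul, hw, one_mul] at h3
      refine h3.congr' ?_
      filter_upwards [hI] with r hr
      rw [hF, mulOp_toFun hθ.1 _ (ofReal_mul_mem_ball hr.1.le hr.2 (norm_circleMap_one t).le)]
  have hpar : Real.circleAverage (fun z => ‖p.toFun z‖ ^ 2) 0 1 = ‖p‖ ^ 2 :=
    (circleAverage_norm_sq_tsum hps).trans (hasSum_norm_sq p).tsum_eq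
  rw [hpar] at hlim
  have hlim' : Tendsto (fun r : ℝ => Real.circleAverage (fun z => ‖F.toFun (r * z)‖ ^ 2) 0 1)
      (𝓝[<] 1) (𝓝 (‖F‖ ^ 2)) := by
    refine (tendsto_tsum_norm_sq F).congr' ?_
    filter_upwards [hI] with r hr
    rw [F.circleAverage_norm_sq hr.1.le hr.2]
  exact (sq_eq_sq₀ (norm_nonneg _) (norm_nonneg _)).1 (tendsto_nhds_unique hlim' hlim)

/-- Multiplication by an inner function is isometric on `H²`, by density of the polynomials. -/
theorem IsInner.norm_mulOp {θ : ℂ → ℂ} (hθ : IsInner θ) (f : HardySpace) :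
    ‖mulOp θ hθ.1 f‖ = ‖f‖ := by
  have h := lp.hasSum_single (p := 2) (by norm_num) f
  refine tendsto_nhds_unique (((mulOp θ hθ.1).continuous.norm.tendsto f).comp h)
    ((h.norm).congr fun s => ?_)
  refine (hθ.norm_mulOp_of_finite _ s fun n hn => ?_).symm
  rw [lp.coeFn_sum, Finset.sum_apply]
  refine Finset.sum_eq_zero fun i hi => ?_
  rw [lp.single_apply_ne]
  rintro rfl
  exact hn hi

/-- Multiplication by an inner function, as an isometry of `H²`. -/
def innerMul {θ : ℂ → ℂ} (hθ : IsInner θ) : HardySpace →ₗᵢ[ℂ] HardySpace :=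
  ⟨(mulOp θ hθ.1 : HardySpace →ₗ[ℂ] HardySpace), hθ.norm_mulOp⟩

theorem innerMul_apply {θ : ℂ → ℂ} (hθ : IsInner θ) (f : HardySpace) :
    innerMul hθ f = mulOp θ hθ.1 f := rfl

theorem IsInner.isClosed_innerMultiples {θ : ℂ → ℂ} (hθ : IsInner θ) :
    IsClosed (innerMultiples θ : Set HardySpace) := by
  have h : (innerMultiples θ : Set HardySpace) = Set.range (innerMul hθ) := by
    ext g
    exact mem_innerMultiples_iff hθ.1
  rw [h]
  exact (innerMul hθ).isometry.isClosedEmbedding.isClosed_range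

theorem IsInner.orthogonal_blockSpace {θ : ℂ → ℂ} (hθ : IsInner θ) :
    (blockSpace θ)ᗮ = innerMultiples θ := by
  rw [Submodule.orthogonal_orthogonal_eq_closure]
  exact hθ.isClosed_innerMultiples.submodule_topologicalClosure_eq

theorem IsInner.exists_ne_zero {θ : ℂ → ℂ} (hθ : IsInner θ) :
    ∃ z ∈ Metric.ball (0 : ℂ) 1, θ z ≠ 0 := by
  obtain ⟨t, w, hw, ht⟩ := hθ.2.exists
  have hw0 : w ≠ 0 := norm_ne_zero_iff.1 (by rw [hw]; exact one_ne_zero)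
  obtain ⟨r, hr, hr'⟩ := ((ht.eventually_ne hw0).and
    (Ioo_mem_nhdsLT (show (0 : ℝ) < 1 by norm_num))).exists
  exact ⟨_, radial_mem_ball hr' t, hr⟩

/-- A quotient of inner functions that belongs to `H^∞` is inner. -/
theorem IsInner.of_mul {θ φ g : ℂ → ℂ} (hθ : IsInner θ) (hφ : IsInner φ) (hg : IsHInfty g)
    (h : ∀ z ∈ Metric.ball (0 : ℂ) 1, θ z = φ z * g z) : IsInner g := by
  refine ⟨hg, ?_⟩
  filter_upwards [hθ.2, hφ.2] with t ⟨w, hw, hwt⟩ ⟨v, hv, hvt⟩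
  have hv0 : v ≠ 0 := norm_ne_zero_iff.1 (by rw [hv]; exact one_ne_zero)
  refine ⟨w / v, by rw [norm_div, hw, hv, div_one], (hwt.div hvt hv0).congr' ?_⟩
  filter_upwards [hvt.eventually_ne hv0,
    Ioo_mem_nhdsLT (show (0 : ℝ) < 1 by norm_num)] with r hr hr'
  rw [Pi.div_apply, h _ (radial_mem_ball hr' t), mul_div_cancel_left₀ _ hr]

/-- An inner function can be cancelled from an identity in the disk. -/
theorem IsInner.mul_left_cancel {θ a b : ℂ → ℂ} (hθ : IsInner θ)
    (ha : DifferentiableOn ℂ a (Metric.ball 0 1)) (hb : DifferentiableOn ℂ b (Metric.ball 0 1))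
    (h : ∀ z ∈ Metric.ball (0 : ℂ) 1, θ z * a z = θ z * b z) :
    ∀ z ∈ Metric.ball (0 : ℂ) 1, a z = b z := by
  have hab : AnalyticOnNhd ℂ (a - b) (Metric.ball 0 1) :=
    (ha.sub hb).analyticOnNhd Metric.isOpen_ball
  rcases (hθ.1.1.analyticOnNhd Metric.isOpen_ball).eq_zero_or_eq_zero_of_mul_eq_zero hab
    (fun z hz => by
      rw [Pi.sub_apply, mul_sub, h z hz, sub_self])
    (convex_ball (0 : ℂ) 1).isPreconnected with h0 | h0
  · obtain ⟨z, hz, hne⟩ := hθ.exists_ne_zero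
    exact absurd (h0 z hz) hne
  · exact fun z hz => sub_eq_zero.1 (h0 z hz)

theorem Equivalent.divides {φ ψ : ℂ → ℂ} (h : Equivalent φ ψ) :
    Divides φ ψ ∧ Divides ψ φ := by
  obtain ⟨c, hc, h⟩ := h
  have hc0 : c ≠ 0 := norm_ne_zero_iff.1 (by rw [hc]; exact one_ne_zero)
  refine ⟨⟨fun _ => c⁻¹, ⟨by fun_prop, ‖c⁻¹‖, fun _ _ => le_rfl⟩, fun z hz => ?_⟩,
    ⟨fun _ => c, ⟨by fun_prop, ‖c‖, fun _ _ => le_rfl⟩, fun z hz => ?_⟩⟩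
  · rw [h z hz]
    field_simp
  · rw [h z hz, mul_comm]

theorem IsHInfty.mul {φ ψ : ℂ → ℂ} (hφ : IsHInfty φ) (hψ : IsHInfty ψ) :
    IsHInfty fun z => φ z * ψ z := by
  obtain ⟨h1, C, hC⟩ := hφ
  obtain ⟨h2, D, hD⟩ := hψ
  refine ⟨h1.mul h2, C * D, fun z hz => ?_⟩
  rw [norm_mul]
  exact mul_le_mul (hC z hz) (hD z hz) (norm_nonneg _) ((norm_nonneg _).trans (hC z hz))

theorem Divides.trans {φ ψ χ : ℂ → ℂ} (h : Divides φ ψ) (h' : Divides ψ χ) : Divides φ χ := by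
  obtain ⟨g, hg, e⟩ := h
  obtain ⟨k, hk, e'⟩ := h'
  exact ⟨fun z => g z * k z, hg.mul hk, fun z hz => by rw [e' z hz, e z hz, mul_assoc]⟩

theorem Divides.innerMultiples_le {φ ψ : ℂ → ℂ} (h : Divides φ ψ) :
    innerMultiples ψ ≤ innerMultiples φ := by
  obtain ⟨g, hg, e⟩ := h
  rintro x ⟨f, hf⟩
  exact ⟨mulOp g hg f, fun z hz => by rw [hf z hz, e z hz, mulOp_toFun hg _ hz, mul_assoc]⟩

theorem Divides.blockSpace_le {φ ψ : ℂ → ℂ} (h : Divides φ ψ) : blockSpace φ ≤ blockSpace ψ :=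
  Submodule.orthogonal_le h.innerMultiples_le

/-! ### The functional calculus -/

section Calculus

theorem map_pow_apply {H K : Type*} [NormedAddCommGroup H] [InnerProductSpace ℂ H]
    [NormedAddCommGroup K] [InnerProductSpace ℂ K] {T : H →L[ℂ] H} {S : K →L[ℂ] K} (A : H →L[ℂ] K)
    (hA : ∀ x, A (T x) = S (A x)) (n : ℕ) (x : H) : A ((T ^ n) x) = (S ^ n) (A x) := by
  induction n generalizing x with
  | zero => rfl
  | succ n ih => rw [pow_succ, pow_succ, mul_apply_eq_comp,
      mul_apply_eq_comp, ih, hA]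

variable {H : Type*} [NormedAddCommGroup H] [InnerProductSpace ℂ H] [CompleteSpace H]
variable {K : Type*} [NormedAddCommGroup K] [InnerProductSpace ℂ K] [CompleteSpace K]

theorem hasSum_dilatedCalculus {u : ℂ → ℂ} (hu : IsHInfty u) {T : H →L[ℂ] H} (hT : ‖T‖ ≤ 1) {r : ℝ}
    (h0 : 0 ≤ r) (h1 : r < 1) (x : H) :
    HasSum (fun n => (taylorCoeff u n * (r : ℂ) ^ n) • (T ^ n) x) (dilatedCalculus u T r x) := by
  have hs : Summable fun n : ℕ => (taylorCoeff u n * (r : ℂ) ^ n) • T ^ n := by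
    refine Summable.of_norm_bounded (summable_norm_taylorCoeff hu.1 h0 h1) fun n => ?_
    rw [norm_smul]
    refine mul_le_of_le_one_right (norm_nonneg _) ?_
    rcases n.eq_zero_or_pos with rfl | hn
    · rw [pow_zero]
      exact ContinuousLinearMap.norm_id_le
    · exact (norm_pow_le' T hn).trans (pow_le_one₀ (norm_nonneg _) hT)
  exact hs.hasSum.mapL (ContinuousLinearMap.apply ℂ H x)

/-- The functional calculus respects intertwining relations. -/
theorem map_dilatedCalculus {u : ℂ → ℂ} (hu : IsHInfty u) {T : H →L[ℂ] H} (hT : ‖T‖ ≤ 1)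
    {S : K →L[ℂ] K} (hS : ‖S‖ ≤ 1) (A : H →L[ℂ] K) (hA : ∀ x, A (T x) = S (A x)) {r : ℝ}
    (h0 : 0 ≤ r) (h1 : r < 1) (x : H) :
    A (dilatedCalculus u T r x) = dilatedCalculus u S r (A x) := by
  refine (((hasSum_dilatedCalculus hu hT h0 h1 x).mapL A).congr_fun fun n => ?_).unique
    (hasSum_dilatedCalculus hu hS h0 h1 (A x))
  rw [map_smul, map_pow_apply A hA]

theorem dilatedCalculus_shift_toFun {u : ℂ → ℂ} (hu : IsHInfty u) {r : ℝ} (h0 : 0 ≤ r) (h1 : r < 1)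
    (f : HardySpace) {z : ℂ} (hz : z ∈ Metric.ball (0 : ℂ) 1) :
    (dilatedCalculus u shift r f).toFun z = u (r * z) * f.toFun z := by
  have h := (hasSum_dilatedCalculus hu norm_shift_le h0 h1 f).mapL (evalAt z hz)
  have hp : ∀ n : ℕ, evalAt z hz ((shift ^ n) f) = z ^ n * f.toFun z := fun n => by
    induction n with
    | zero => simp [evalAt_apply]
    | succ n ih =>
      rw [pow_succ', mul_apply_eq_comp, evalAt_apply, shift_toFun _ hz,
        ← evalAt_apply z hz, ih]
      ring
  rw [evalAt_apply] at h
  refine h.unique ?_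
  have hz' : ‖z‖ ≤ 1 := by simpa using (mem_ball_zero_iff.1 hz).le
  refine ((hasSum_taylorCoeff hu.1 (ofReal_mul_mem_ball h0 h1 hz')).mul_right
    (f.toFun z)).congr_fun fun n => ?_
  rw [map_smul, hp, smul_eq_mul, mul_pow]
  ring

theorem norm_dilatedCalculus_shift_le {u : ℂ → ℂ} (hu : IsHInfty u) {C : ℝ}
    (hC : ∀ z ∈ Metric.ball (0 : ℂ) 1, ‖u z‖ ≤ C) {r : ℝ} (h0 : 0 ≤ r) (h1 : r < 1)
    (f : HardySpace) : ‖dilatedCalculus u shift r f‖ ≤ C * ‖f‖ := by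
  have hball : ∀ z ∈ Metric.ball (0 : ℂ) 1, (r : ℂ) * z ∈ Metric.ball (0 : ℂ) 1 := fun z hz =>
    ofReal_mul_mem_ball h0 h1 (by simpa using (mem_ball_zero_iff.1 hz).le)
  have hd : DifferentiableOn ℂ (fun z => u (r * z)) (Metric.ball 0 1) :=
    hu.1.comp (by fun_prop) hball
  obtain ⟨F, hF, hFC⟩ := IsHInfty.exists_mul hd (fun z hz => hC _ (hball z hz)) f
  rwa [ext_toFun (f := dilatedCalculus u shift r f) (g := F) fun z hz => by
    rw [hF z hz, dilatedCalculus_shift_toFun hu h0 h1 f hz]]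

/-- In the functional calculus of the shift, `u` acts as multiplication by `u`. With `D_r` the
dilation by `r`, one has `u(rS) f - u f = u(rS) (f - D_r f) + (D_r (u f) - u f)`. -/
theorem tendsto_dilatedCalculus_shift {u : ℂ → ℂ} (hu : IsHInfty u) (f : HardySpace) :
    Tendsto (fun r : ℝ => dilatedCalculus u shift r f) (𝓝[<] 1) (𝓝 (mulOp u hu f)) := by
  obtain ⟨C, hC⟩ := hu.2
  obtain ⟨D, hD, hDf⟩ := exists_dilation f
  obtain ⟨D', hD', hDf'⟩ := exists_dilation (mulOp u hu f)
  have hI := Ioo_mem_nhdsLT (show (0 : ℝ) < 1 by norm_num)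
  have h1 : Tendsto (fun r : ℝ => dilatedCalculus u shift r (f - D r)) (𝓝[<] 1) (𝓝 0) := by
    have hb : Tendsto (fun r : ℝ => C * ‖f - D r‖) (𝓝[<] 1) (𝓝 0) := by
      simpa using ((tendsto_const_nhds (x := f)).sub hDf).norm.const_mul C
    refine squeeze_zero_norm' ?_ hb
    filter_upwards [hI] with r hr
    exact norm_dilatedCalculus_shift_le hu hC hr.1.le hr.2 _
  have h2 := h1.add hDf'
  rw [zero_add] at h2
  refine h2.congr' ?_
  filter_upwards [hI] with r hr
  have e : dilatedCalculus u shift r (D r) = D' r := ext_toFun fun z hz => by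
    have hz' : ‖z‖ ≤ 1 := by simpa using (mem_ball_zero_iff.1 hz).le
    rw [dilatedCalculus_shift_toFun hu hr.1.le hr.2 _ hz, hD r hr.1.le hr.2,
      hD' r hr.1.le hr.2, mulOp_toFun hu _ (ofReal_mul_mem_ball hr.1.le hr.2 hz')]
  rw [map_sub, e, sub_add_cancel]

end Calculus

/-! ### Jordan blocks -/

section Blocks

open ContinuousLinearMap

variable {θ φ ψ : ℂ → ℂ}

theorem shift_mem_orthogonal_blockSpace {f : HardySpace} (hf : f ∈ (blockSpace θ)ᗮ) :
    shift f ∈ (blockSpace θ)ᗮ := by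
  rw [Submodule.orthogonal_orthogonal_eq_closure] at hf ⊢
  have h : Set.MapsTo shift (innerMultiples θ) (innerMultiples θ) := fun g hg =>
    shift_mem_innerMultiples hg
  exact h.closure shift.continuous hf

theorem adjoint_shift_mem_blockSpace {f : HardySpace} (hf : f ∈ blockSpace θ) :
    adjoint shift f ∈ blockSpace θ := by
  rw [Submodule.mem_orthogonal] at hf ⊢
  intro g hg
  rw [adjoint_inner_right]
  exact hf _ (shift_mem_innerMultiples hg)

/-- The projection of `H²` onto `ℋ(θ)`. -/
abbrev blockProj (θ : ℂ → ℂ) : HardySpace →L[ℂ] blockSpace θ :=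
  (blockSpace θ).orthogonalProjectionOnto

theorem jordanBlock_apply (x : blockSpace θ) : jordanBlock θ x = blockProj θ (shift x) := rfl

theorem blockProj_eq_zero {f : HardySpace} (hf : f ∈ (blockSpace θ)ᗮ) : blockProj θ f = 0 :=
  Submodule.orthogonalProjectionOnto_apply_of_mem_orthogonal hf

theorem sub_blockProj_mem (f : HardySpace) : f - blockProj θ f ∈ (blockSpace θ)ᗮ :=
  (blockSpace θ).sub_starProjection_mem_orthogonal f

theorem blockProj_coe (x : blockSpace θ) : blockProj θ (x : HardySpace) = x :=
  Submodule.orthogonalProjectionOnto_mem_subspace_eq_self x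

theorem shift_sub_jordanBlock_mem (x : blockSpace θ) :
    shift x - jordanBlock θ x ∈ (blockSpace θ)ᗮ := sub_blockProj_mem _

/-- The projection onto `ℋ(θ)` intertwines the shift and the Jordan block. -/
theorem blockProj_shift (f : HardySpace) :
    blockProj θ (shift f) = jordanBlock θ (blockProj θ f) := by
  rw [jordanBlock_apply, ← sub_eq_zero, ← map_sub, ← map_sub]
  exact blockProj_eq_zero (shift_mem_orthogonal_blockSpace (sub_blockProj_mem f))

/-- The adjoint of a Jordan block is a restriction of the backward shift. -/
theorem coe_adjoint_jordanBlock (x : blockSpace θ) :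
    (adjoint (jordanBlock θ) x : HardySpace) = adjoint shift (x : HardySpace) := by
  suffices h : adjoint (jordanBlock θ) x = ⟨_, adjoint_shift_mem_blockSpace x.2⟩ from
    congrArg Subtype.val h
  refine ext_inner_right ℂ fun y => ?_
  rw [adjoint_inner_left, jordanBlock_apply,
    Submodule.inner_orthogonalProjectionOnto_eq_of_mem_left, Submodule.coe_inner,
    adjoint_inner_left]

theorem adjoint_shift_apply (f : HardySpace) (n : ℕ) : adjoint shift f n = f (n + 1) := by
  have h1 : inner ℂ (lp.single (E := fun _ : ℕ => ℂ) 2 n (1 : ℂ)) (adjoint shift f) =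
      adjoint shift f n := by
    rw [lp.inner_single_left]
    simp
  have h2 : shift (lp.single (E := fun _ : ℕ => ℂ) 2 n (1 : ℂ)) =
      lp.single (E := fun _ : ℕ => ℂ) 2 (n + 1) (1 : ℂ) := by
    refine lp.ext (funext fun k => ?_)
    cases k with
    | zero =>
      exact (lp.single_apply_ne (E := fun _ : ℕ => ℂ) 2 (n + 1) (1 : ℂ) (Nat.succ_ne_zero n).symm).symm
    | succ k =>
      change lp.single (E := fun _ : ℕ => ℂ) 2 n (1 : ℂ) k = _
      rw [lp.single_apply, lp.single_apply]
      simp [Pi.single_apply]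
  rw [← h1, adjoint_inner_right, h2, lp.inner_single_left]
  simp

theorem adjoint_shift_pow_apply (n : ℕ) (f : HardySpace) (k : ℕ) :
    (adjoint shift ^ n) f k = f (k + n) := by
  induction n generalizing f with
  | zero => rfl
  | succ n ih =>
    rw [pow_succ, mul_apply_eq_comp, ih, adjoint_shift_apply, add_assoc]

theorem tendsto_adjoint_shift_pow (f : HardySpace) :
    Tendsto (fun n => (adjoint shift ^ n) f) atTop (𝓝 0) := by
  have h := tendsto_sum_nat_add fun n => ‖f n‖ ^ 2
  have e : ∀ n, ∑' k, ‖f (k + n)‖ ^ 2 = ‖(adjoint shift ^ n) f‖ ^ 2 := fun n => by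
    rw [← (hasSum_norm_sq _).tsum_eq]
    exact tsum_congr fun k => by rw [adjoint_shift_pow_apply]
  simp only [e] at h
  rw [tendsto_zero_iff_norm_tendsto_zero]
  simpa using h.sqrt

theorem tendsto_adjoint_jordanBlock_pow (x : blockSpace θ) :
    Tendsto (fun n => (adjoint (jordanBlock θ) ^ n) x) atTop (𝓝 0) := by
  rw [tendsto_zero_iff_norm_tendsto_zero]
  have h := (tendsto_adjoint_shift_pow (x : HardySpace)).norm
  rw [norm_zero] at h
  refine h.congr fun n => ?_
  exact congrArg norm
    (map_pow_apply (blockSpace θ).subtypeL coe_adjoint_jordanBlock n x).symm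

theorem norm_adjoint_jordanBlock_le (θ : ℂ → ℂ) : ‖adjoint (jordanBlock θ)‖ ≤ 1 := by
  rw [LinearIsometryEquiv.norm_map]
  exact norm_jordanBlock_le θ

theorem norm_dilatedCalculus_jordanBlock_le {u : ℂ → ℂ} (hu : IsHInfty u) {C : ℝ}
    (hC : ∀ z ∈ Metric.ball (0 : ℂ) 1, ‖u z‖ ≤ C) {r : ℝ} (h0 : 0 ≤ r) (h1 : r < 1)
    (x : blockSpace θ) : ‖dilatedCalculus u (jordanBlock θ) r x‖ ≤ C * ‖x‖ := by
  have h := map_dilatedCalculus hu norm_shift_le (norm_jordanBlock_le θ) (blockProj θ)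
    blockProj_shift h0 h1 (x : HardySpace)
  rw [blockProj_coe] at h
  rw [← h]
  exact ((blockSpace θ).norm_orthogonalProjectionOnto_apply_le _).trans
    (norm_dilatedCalculus_shift_le hu hC h0 h1 _)

/-- A multiple of `θ` annihilates the Jordan block `S(θ)`. -/
theorem tendsto_dilatedCalculus_jordanBlock {u : ℂ → ℂ} (hu : IsHInfty u) (h : Divides θ u)
    (x : blockSpace θ) :
    Tendsto (fun r : ℝ => dilatedCalculus u (jordanBlock θ) r x) (𝓝[<] 1) (𝓝 0) := by
  have hlim := ((blockProj θ).continuous.tendsto _).comp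
    (tendsto_dilatedCalculus_shift hu (x : HardySpace))
  rw [blockProj_eq_zero (Submodule.le_orthogonal_orthogonal _
    (h.innerMultiples_le (mulOp_mem_innerMultiples hu _)))] at hlim
  refine hlim.congr' ?_
  filter_upwards [Ioo_mem_nhdsLT (show (0 : ℝ) < 1 by norm_num)] with r hr
  have e := map_dilatedCalculus hu norm_shift_le (norm_jordanBlock_le θ) (blockProj θ)
    blockProj_shift hr.1.le hr.2 (x : HardySpace)
  rw [blockProj_coe] at e
  exact e

/-- If `φ` is inner and `θ = φ ψ`, multiplication by `φ` maps `ℋ(ψ)` into `ℋ(θ)`. -/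
theorem innerMul_mem_blockSpace_iff (hφ : IsInner φ) (hψ : IsInner ψ)
    (h : ∀ z ∈ Metric.ball (0 : ℂ) 1, θ z = φ z * ψ z) {f : HardySpace} :
    innerMul hφ f ∈ blockSpace θ ↔ f ∈ blockSpace ψ := by
  simp only [Submodule.mem_orthogonal]
  constructor
  · rintro hf g ⟨k, hk⟩
    rw [← (innerMul hφ).inner_map_map]
    refine hf _ ⟨k, fun z hz => ?_⟩
    rw [innerMul_apply, mulOp_toFun _ _ hz, hk z hz, h z hz, mul_assoc]
  · rintro hf g ⟨k, hk⟩
    have hg : g = innerMul hφ (mulOp ψ hψ.1 k) := HardySpace.ext_toFun fun z hz => by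
      rw [innerMul_apply, mulOp_toFun _ _ hz, mulOp_toFun _ _ hz, hk z hz, h z hz, mul_assoc]
    rw [hg, (innerMul hφ).inner_map_map]
    exact hf _ (mulOp_mem_innerMultiples _ _)

theorem innerMul_mem_orthogonal_blockSpace (hφ : IsInner φ) (f : HardySpace) :
    innerMul hφ f ∈ (blockSpace φ)ᗮ :=
  Submodule.le_orthogonal_orthogonal _ (mulOp_mem_innerMultiples hφ.1 f)

/-- For `θ = φ ψ`, multiplication by `φ` as an isometry of `ℋ(ψ)` into `ℋ(θ)`. -/
def blockMul (hφ : IsInner φ) (hψ : IsInner ψ)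
    (h : ∀ z ∈ Metric.ball (0 : ℂ) 1, θ z = φ z * ψ z) : blockSpace ψ →ₗᵢ[ℂ] blockSpace θ where
  toFun f := ⟨innerMul hφ f, (innerMul_mem_blockSpace_iff hφ hψ h).2 f.2⟩
  map_add' f g := Subtype.ext (map_add (innerMul hφ) (f : HardySpace) g)
  map_smul' c f := Subtype.ext (map_smul (innerMul hφ) c (f : HardySpace))
  norm_map' f := (innerMul hφ).norm_map f

theorem coe_blockMul (hφ : IsInner φ) (hψ : IsInner ψ)
    (h : ∀ z ∈ Metric.ball (0 : ℂ) 1, θ z = φ z * ψ z) (f : blockSpace ψ) :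
    (blockMul hφ hψ h f : HardySpace) = innerMul hφ f := rfl

/-- Multiplication by `φ` intertwines `S(ψ)` and `S(φ ψ)`. -/
theorem blockMul_jordanBlock (hφ : IsInner φ) (hψ : IsInner ψ)
    (h : ∀ z ∈ Metric.ball (0 : ℂ) 1, θ z = φ z * ψ z) (f : blockSpace ψ) :
    blockMul hφ hψ h (jordanBlock ψ f) = jordanBlock θ (blockMul hφ hψ h f) := by
  have hmem := shift_sub_jordanBlock_mem f
  rw [hψ.orthogonal_blockSpace] at hmem
  obtain ⟨k, hk⟩ := hmem
  have hz : blockProj θ (innerMul hφ (shift f - jordanBlock ψ f)) = 0 := by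
    refine blockProj_eq_zero (Submodule.le_orthogonal_orthogonal _ ⟨k, fun z hz => ?_⟩)
    rw [innerMul_apply, mulOp_toFun _ _ hz, hk z hz, h z hz, mul_assoc]
  rw [map_sub, map_sub, sub_eq_zero, ← coe_blockMul hφ hψ h, blockProj_coe] at hz
  rw [← hz, jordanBlock_apply (blockMul hφ hψ h f), coe_blockMul,
    innerMul_apply, innerMul_apply, shift_mulOp]

/-- The inclusion `ℋ(φ) ⊆ ℋ(θ)` for `φ ∣ θ`, as an isometry. -/
def blockIncl (h : Divides φ θ) : blockSpace φ →ₗᵢ[ℂ] blockSpace θ :=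
  ⟨Submodule.inclusion h.blockSpace_le, fun _ => rfl⟩

theorem coe_blockIncl (h : Divides φ θ) (f : blockSpace φ) :
    (blockIncl h f : HardySpace) = f := rfl

/-- The inclusion of blocks intertwines the adjoints of the Jordan blocks. -/
theorem blockIncl_adjoint_jordanBlock (h : Divides φ θ) (f : blockSpace φ) :
    blockIncl h (adjoint (jordanBlock φ) f) = adjoint (jordanBlock θ) (blockIncl h f) :=
  Subtype.ext (by
    rw [coe_blockIncl, coe_adjoint_jordanBlock, coe_adjoint_jordanBlock, coe_blockIncl])

end Blocks

/-! ### Hilbert space direct sums -/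

section DirectSums

open ContinuousLinearMap

section Coordinates

variable {ι : Type*} {E : ι → Type*} [∀ i, NormedAddCommGroup (E i)]
  [∀ i, InnerProductSpace ℂ (E i)]
variable {F : ι → Type*} [∀ i, NormedAddCommGroup (F i)] [∀ i, InnerProductSpace ℂ (F i)]

theorem directSum_apply (T : ∀ i, E i →L[ℂ] E i) (hT : ∀ i, ‖T i‖ ≤ 1) (f : lp E 2) (i : ι) :
    directSum T hT f i = T i (f i) := rfl

theorem norm_directSum_le (T : ∀ i, E i →L[ℂ] E i) (hT : ∀ i, ‖T i‖ ≤ 1) :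
    ‖directSum T hT‖ ≤ 1 := by
  unfold directSum
  exact LinearMap.mkContinuous_norm_le _ zero_le_one _

/-- The evaluation of the `i`-th coordinate in a Hilbert space direct sum. -/
abbrev coord (E : ι → Type*) [∀ i, NormedAddCommGroup (E i)] [∀ i, InnerProductSpace ℂ (E i)]
    (i : ι) : lp E 2 →L[ℂ] E i := lp.evalCLM ℂ E 2 i

open Classical in
theorem directSum_single (T : ∀ i, E i →L[ℂ] E i) (hT : ∀ i, ‖T i‖ ≤ 1) (i : ι) (x : E i) :
    directSum T hT (lp.single 2 i x) = lp.single 2 i (T i x) := by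
  refine lp.ext (funext fun j => ?_)
  rw [directSum_apply]
  by_cases h : j = i
  · subst h
    rw [lp.single_apply_self, lp.single_apply_self]
  · rw [lp.single_apply_ne _ _ _ h, lp.single_apply_ne _ _ _ h, map_zero]

theorem adjoint_directSum_apply [∀ i, CompleteSpace (E i)] (T : ∀ i, E i →L[ℂ] E i)
    (hT : ∀ i, ‖T i‖ ≤ 1) (f : lp E 2) (i : ι) :
    adjoint (directSum T hT) f i = adjoint (T i) (f i) := by
  classical
  refine ext_inner_left ℂ fun y => ?_
  rw [← lp.inner_single_left, adjoint_inner_right, adjoint_inner_right, directSum_single,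
    lp.inner_single_left]

/-- A subspace that contains all the coordinate vectors of a direct sum is dense. -/
theorem dense_of_single_mem [DecidableEq ι] (R : Submodule ℂ (lp E 2))
    (h : ∀ i x, lp.single 2 i x ∈ R) : Dense (R : Set (lp E 2)) := fun f =>
  mem_closure_of_tendsto (lp.hasSum_single (p := 2) (by norm_num) f)
    (Eventually.of_forall fun _ => R.sum_mem fun i _ => h i _)

/-- The coordinatewise sum of isometries. -/
def sumIsometry (A : ∀ i, E i →ₗᵢ[ℂ] F i) : lp E 2 →ₗᵢ[ℂ] lp F 2 where
  toFun f := ⟨fun i => A i (f i), memℓp_two_of_summable (by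
    simpa only [LinearIsometry.norm_map] using (hasSum_norm_sq f).summable)⟩
  map_add' f g := lp.ext (funext fun i => map_add (A i) (f i) (g i))
  map_smul' c f := lp.ext (funext fun i => map_smul (A i) c (f i))
  norm_map' f := by
    refine (sq_eq_sq₀ (norm_nonneg _) (norm_nonneg _)).1 ?_
    rw [← (hasSum_norm_sq f).tsum_eq, ← (hasSum_norm_sq _).tsum_eq]
    exact tsum_congr fun i => by
      change ‖A i (f i)‖ ^ 2 = _
      rw [LinearIsometry.norm_map]

theorem exists_sumIsometry_eq (A : ∀ i, E i →ₗᵢ[ℂ] F i) (g : lp F 2)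
    (h : ∀ i, ∃ x, A i x = g i) : ∃ f, sumIsometry A f = g := by
  choose x hx using h
  refine ⟨⟨x, memℓp_two_of_summable ?_⟩, lp.ext (funext hx)⟩
  refine (hasSum_norm_sq g).summable.congr fun i => ?_
  rw [← hx, LinearIsometry.norm_map]

end Coordinates

/-! ### Completely nonunitary contractions -/

/-- A contraction whose adjoint has powers tending strongly to `0` is completely nonunitary: if `T`
is unitary on `M` and `y = Tⁿ x` with `x, y ∈ M`, then `‖y‖² = ⟪x, T*ⁿ y⟫ ≤ ‖y‖ ‖T*ⁿ y‖`. -/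
theorem isCNUContraction_of_tendsto {H : Type*} [NormedAddCommGroup H] [InnerProductSpace ℂ H]
    [CompleteSpace H] {T : H →L[ℂ] H} (hT : ‖T‖ ≤ 1)
    (h : ∀ x, Tendsto (fun n => (adjoint T ^ n) x) atTop (𝓝 0)) : IsCNUContraction T := by
  refine ⟨hT, fun M _ hM hiso => (Submodule.eq_bot_iff M).2 fun y hy => ?_⟩
  have hpre : ∀ n : ℕ, ∀ y ∈ M, ∃ x, (T ^ n) x = y ∧ ‖x‖ = ‖y‖ := by
    intro n
    induction n with
    | zero => exact fun y _ => ⟨y, rfl, rfl⟩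
    | succ n ih =>
      intro y hy
      rw [← hM] at hy
      obtain ⟨w, hw, rfl⟩ := hy
      obtain ⟨x, rfl, hx⟩ := ih w hw
      exact ⟨x, by rw [pow_succ', mul_apply_eq_comp]; rfl, hx.trans (hiso _ hw).symm⟩
  have hle : ∀ n : ℕ, ‖y‖ ^ 2 ≤ ‖y‖ * ‖(adjoint T ^ n) y‖ := by
    intro n
    obtain ⟨x, hxy, hx⟩ := hpre n y hy
    have e : adjoint (T ^ n) = adjoint T ^ n := by
      simpa only [star_eq_adjoint] using star_pow T n
    calc ‖y‖ ^ 2 = ‖inner ℂ ((T ^ n) x) y‖ := by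
          rw [hxy, inner_self_eq_norm_sq_to_K]
          simp
      _ = ‖inner ℂ x ((adjoint T ^ n) y)‖ := by rw [← e, adjoint_inner_right]
      _ ≤ ‖x‖ * ‖(adjoint T ^ n) y‖ := norm_inner_le_norm _ _
      _ = ‖y‖ * ‖(adjoint T ^ n) y‖ := by rw [hx]
  have hlim := ((h y).norm.const_mul ‖y‖)
  rw [norm_zero, mul_zero] at hlim
  have := ge_of_tendsto' hlim hle
  exact norm_eq_zero.1 (pow_eq_zero_iff two_ne_zero |>.1 (le_antisymm this (by positivity)))

/-- A direct sum of Jordan blocks `S(θᵢ)`, all of whose `θᵢ` divide a fixed nonzero bounded analytic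
function, is of class `C₀`. -/
theorem isClassC0_directSum {ι : Type*} (Θ : ι → ℂ → ℂ) {u : ℂ → ℂ} (hu : IsHInfty u)
    (hu0 : ∃ z ∈ Metric.ball (0 : ℂ) 1, u z ≠ 0) (hdvd : ∀ i, Divides (Θ i) u) :
    IsClassC0 (directSum (fun i => jordanBlock (Θ i)) fun i => norm_jordanBlock_le (Θ i)) := by
  set T := directSum (fun i => jordanBlock (Θ i)) fun i => norm_jordanBlock_le (Θ i) with hT
  have hT1 : ‖T‖ ≤ 1 := norm_directSum_le _ _
  refine ⟨isCNUContraction_of_tendsto hT1 fun x => ?_, u, hu, hu0, fun x => ?_⟩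
  · have hc : ∀ n i, (adjoint T ^ n) x i = (adjoint (jordanBlock (Θ i)) ^ n) (x i) := fun n i =>
      map_pow_apply (coord _ i) (fun y => adjoint_directSum_apply _ _ y i) n x
    refine tendsto_zero_of_dominated (hasSum_norm_sq x).summable
      (Eventually.of_forall fun n i => ?_) fun i => ?_
    · rw [hc]
      gcongr
      rcases n.eq_zero_or_pos with rfl | hn
      · exact le_rfl
      · refine (le_of_opNorm_le _ ((norm_pow_le' _ hn).trans
          (pow_le_one₀ (norm_nonneg _) (norm_adjoint_jordanBlock_le _))) _).trans_eq (one_mul _)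
    · simp only [hc]
      exact tendsto_adjoint_jordanBlock_pow _
  · obtain ⟨C, hC⟩ := hu.2
    have hI := Ioo_mem_nhdsLT (show (0 : ℝ) < 1 by norm_num)
    have hc : ∀ r ∈ Set.Ioo (0 : ℝ) 1, ∀ i,
        dilatedCalculus u T r x i = dilatedCalculus u (jordanBlock (Θ i)) r (x i) := fun r hr i =>
      map_dilatedCalculus hu hT1 (norm_jordanBlock_le _) (coord _ i) (fun _ => rfl) hr.1.le hr.2 x
    refine tendsto_zero_of_dominated ((hasSum_norm_sq x).summable.mul_left (C ^ 2)) ?_ fun i => ?_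
    · filter_upwards [hI] with r hr i
      rw [hc r hr, ← mul_pow]
      gcongr
      exact norm_dilatedCalculus_jordanBlock_le hu hC hr.1.le hr.2 _
    · refine (tendsto_dilatedCalculus_jordanBlock hu (hdvd i) (x i)).congr' ?_
      filter_upwards [hI] with r hr
      rw [hc r hr]

/-! ### Absorption of summands -/

section Absorption

variable {ι ι₂ : Type*} {D : ι₂ → Type*} [∀ i, NormedAddCommGroup (D i)] {a b : ι → ι₂}
  {e : ι ≃ ι × ℕ}

/-- The bound for `absorb` below: the sum over `j` is at most `2 ‖f‖² + 2 (4 / 3) ‖f‖²`, the factor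
`4 / 3` coming from the geometric series over the second component of `e j`. -/
theorem hasSum_absorb_bound (ha : Function.Injective a) (hb : Function.Injective b) (f : lp D 2) :
    ∃ S, HasSum (fun j => 2 * ‖f (a j)‖ ^ 2 + 2 * (‖f (b (e j).1)‖ ^ 2 * (1 / 4 : ℝ) ^ (e j).2)) S ∧
      S ≤ (3 * ‖f‖) ^ 2 := by
  have hf := hasSum_norm_sq f
  have h1 : Summable fun j => ‖f (a j)‖ ^ 2 := hf.summable.comp_injective ha
  have h2 : Summable fun i => ‖f (b i)‖ ^ 2 := hf.summable.comp_injective hb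
  have l1 : ∑' j, ‖f (a j)‖ ^ 2 ≤ ‖f‖ ^ 2 := by
    rw [← hf.tsum_eq]
    exact tsum_comp_le_tsum_of_inj hf.summable (fun _ => by positivity) ha
  have l2 : ∑' j, ‖f (b j)‖ ^ 2 ≤ ‖f‖ ^ 2 := by
    rw [← hf.tsum_eq]
    exact tsum_comp_le_tsum_of_inj hf.summable (fun _ => by positivity) hb
  have hg := hasSum_geometric_of_lt_one (show (0 : ℝ) ≤ 1 / 4 by norm_num) (by norm_num)
  have h3 := h2.hasSum.mul hg (h2.mul_of_nonneg hg.summable (fun _ => by positivity)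
    fun _ => by positivity)
  have h4 := (e.hasSum_iff (f := fun p : ι × ℕ => ‖f (b p.1)‖ ^ 2 * (1 / 4 : ℝ) ^ p.2)).2 h3
  refine ⟨_, (h1.hasSum.mul_left 2).add (h4.mul_left 2), ?_⟩
  norm_num
  nlinarith [sq_nonneg ‖f‖]

variable [∀ i, InnerProductSpace ℂ (D i)]

/-- The map `f ↦ (2^{-k} (f (a j) + V_j f (b i)))_j`, where `e j = (i, k)`. Every summand `D (b i)`
is spread over the infinitely many summands `D (a j)` with `(e j).1 = i`. -/
def absorb (ha : Function.Injective a) (hb : Function.Injective b)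
    (V : ∀ j, D (b (e j).1) →ₗᵢ[ℂ] D (a j)) : lp D 2 →L[ℂ] lp (fun j => D (a j)) 2 :=
  have hle : ∀ (f : lp D 2) (j : ι),
      ‖((1 / 2 : ℂ) ^ (e j).2) • (f (a j) + V j (f (b (e j).1)))‖ ^ 2 ≤
        2 * ‖f (a j)‖ ^ 2 + 2 * (‖f (b (e j).1)‖ ^ 2 * (1 / 4 : ℝ) ^ (e j).2) := fun f j => by
    have h1 : ‖f (a j) + V j (f (b (e j).1))‖ ≤ ‖f (a j)‖ + ‖f (b (e j).1)‖ := by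
      simpa using norm_add_le (f (a j)) (V j (f (b (e j).1)))
    have h2 : ((1 / 2 : ℝ) ^ (e j).2) ^ 2 = (1 / 4 : ℝ) ^ (e j).2 := by
      rw [← pow_mul, mul_comm, pow_mul]
      norm_num
    have h3 : (1 / 4 : ℝ) ^ (e j).2 ≤ 1 := pow_le_one₀ (by norm_num) (by norm_num)
    have h4 : ‖(1 / 2 : ℂ) ^ (e j).2‖ = (1 / 2 : ℝ) ^ (e j).2 := by simp
    rw [norm_smul, mul_pow, h4, h2]
    have h5 : ‖f (a j) + V j (f (b (e j).1))‖ ^ 2 ≤ 2 * ‖f (a j)‖ ^ 2 + 2 * ‖f (b (e j).1)‖ ^ 2 := by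
      nlinarith [sq_nonneg (‖f (a j)‖ - ‖f (b (e j).1)‖), norm_nonneg (f (a j)),
        norm_nonneg (f (b (e j).1)), norm_nonneg (f (a j) + V j (f (b (e j).1)))]
    have h6 : (0 : ℝ) ≤ (1 / 4) ^ (e j).2 := by positivity
    nlinarith [mul_le_mul_of_nonneg_left h5 h6,
      mul_nonneg (sub_nonneg.2 h3) (sq_nonneg ‖f (a j)‖)]
  have hsum : ∀ f : lp D 2, Summable fun j =>
      ‖((1 / 2 : ℂ) ^ (e j).2) • (f (a j) + V j (f (b (e j).1)))‖ ^ 2 := fun f => by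
    obtain ⟨S, hS, -⟩ := hasSum_absorb_bound (e := e) ha hb f
    exact Summable.of_nonneg_of_le (fun _ => by positivity) (hle f) hS.summable
  LinearMap.mkContinuous
    { toFun := fun f => ⟨fun j => ((1 / 2 : ℂ) ^ (e j).2) • (f (a j) + V j (f (b (e j).1))),
        memℓp_two_of_summable (hsum f)⟩
      map_add' := fun f g => lp.ext (funext fun j => by
        simp only [lp.coeFn_add, Pi.add_apply, map_add, ← smul_add]
        congr 1
        abel)
      map_smul' := fun c f => lp.ext (funext fun j => by
        simp only [lp.coeFn_smul, Pi.smul_apply, map_smul, ← smul_add, RingHom.id_apply]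
        rw [smul_comm]) } 3
    fun f => by
      obtain ⟨S, hS, hSle⟩ := hasSum_absorb_bound (e := e) ha hb f
      refine (sq_le_sq₀ (norm_nonneg _) (by positivity)).1 ?_
      refine le_trans ?_ hSle
      rw [← (hasSum_norm_sq _).tsum_eq, ← hS.tsum_eq]
      exact (hsum f).tsum_le_tsum (hle f) hS.summable

theorem absorb_apply (ha : Function.Injective a) (hb : Function.Injective b)
    (V : ∀ j, D (b (e j).1) →ₗᵢ[ℂ] D (a j)) (f : lp D 2) (j : ι) :
    absorb ha hb V f j = ((1 / 2 : ℂ) ^ (e j).2) • (f (a j) + V j (f (b (e j).1))) := rfl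

/-- If `absorb f = 0`, the norms `‖f (a j)‖`, for all `j` with `(e j).1 = i`, agree with
`‖f (b i)‖`; being square-summable, they vanish. -/
theorem absorb_injective (ha : Function.Injective a) (hb : Function.Injective b)
    (hcover : ∀ p, (∃ j, a j = p) ∨ ∃ j, b j = p)
    (V : ∀ j, D (b (e j).1) →ₗᵢ[ℂ] D (a j)) : Function.Injective (absorb ha hb V) := by
  rw [injective_iff_map_eq_zero]
  intro f hf
  have h1 : ∀ j, ‖f (a j)‖ = ‖f (b (e j).1)‖ := fun j => by
    have h := congrArg (fun g : lp (fun j => D (a j)) 2 => g j) hf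
    simp only [absorb_apply, lp.coeFn_zero, Pi.zero_apply] at h
    rw [smul_eq_zero_iff_right (pow_ne_zero _ (by norm_num)), add_eq_zero_iff_eq_neg] at h
    rw [h, norm_neg, LinearIsometry.norm_map]
  have h2 : ∀ i, f (b i) = 0 := fun i => by
    have hs : Summable fun k : ℕ => ‖f (a (e.symm (i, k)))‖ ^ 2 :=
      (hasSum_norm_sq f).summable.comp_injective (i := fun k : ℕ => a (e.symm (i, k)))
        (ha.comp (e.symm.injective.comp (Prod.mk_right_injective i)))
    have h3 : ∀ k : ℕ, ‖f (b (e (e.symm (i, k))).1)‖ = ‖f (b i)‖ := fun k => by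
      rw [e.apply_symm_apply]
    simp only [h1, h3, summable_const_iff] at hs
    simpa using hs
  refine lp.ext (funext fun p => ?_)
  rcases hcover p with ⟨j, rfl⟩ | ⟨j, rfl⟩
  · have := h1 j
    rw [h2, norm_zero, norm_eq_zero] at this
    exact this
  · exact h2 j

theorem absorb_denseRange (ha : Function.Injective a) (hb : Function.Injective b)
    (hab : ∀ i j, a i ≠ b j) (V : ∀ j, D (b (e j).1) →ₗᵢ[ℂ] D (a j)) :
    DenseRange (absorb ha hb V) := by
  classical
  refine dense_of_single_mem (absorb ha hb V).range fun j y => ?_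
  refine ⟨lp.single 2 (a j) ((2 : ℂ) ^ (e j).2 • y), lp.ext (funext fun k => ?_)⟩
  change absorb ha hb V _ k = _
  rw [absorb_apply, lp.single_apply_ne _ _ _ (hab j _).symm, map_zero, add_zero]
  by_cases h : k = j
  · subst h
    rw [lp.single_apply_self, lp.single_apply_self, smul_smul, ← mul_pow]
    norm_num
  · rw [lp.single_apply_ne _ _ _ (ha.ne h), lp.single_apply_ne _ _ _ h, smul_zero]

theorem absorb_directSum (ha : Function.Injective a) (hb : Function.Injective b)
    (V : ∀ j, D (b (e j).1) →ₗᵢ[ℂ] D (a j)) (T : ∀ p, D p →L[ℂ] D p)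
    (hV : ∀ j x, V j (T _ x) = T _ (V j x)) {A : lp D 2 →L[ℂ] lp D 2}
    (hA : ∀ f p, A f p = T p (f p))
    {B : lp (fun j => D (a j)) 2 →L[ℂ] lp (fun j => D (a j)) 2}
    (hB : ∀ f j, B f j = T (a j) (f j)) :
    absorb ha hb V ∘L A = B ∘L absorb ha hb V := by
  ext f j
  simp only [comp_apply, hB, absorb_apply, hA, map_smul, map_add, hV]

theorem denseRange_adjoint {H K : Type*} [NormedAddCommGroup H] [InnerProductSpace ℂ H]
    [CompleteSpace H] [NormedAddCommGroup K] [InnerProductSpace ℂ K] [CompleteSpace K]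
    {X : H →L[ℂ] K} (hX : Function.Injective X) : DenseRange (adjoint X) := by
  have h : (adjoint X).range.topologicalClosure = ⊤ := by
    rw [Submodule.topologicalClosure_eq_top_iff, Submodule.eq_bot_iff]
    intro x hx
    refine hX ?_
    rw [map_zero]
    refine ext_inner_left ℂ fun y => ?_
    rw [inner_zero_right, ← adjoint_inner_left]
    exact hx _ ⟨y, rfl⟩
  exact (Submodule.dense_iff_topologicalClosure_eq_top (s := (adjoint X).range)).2 h

theorem adjoint_injective_of_denseRange {H K : Type*} [NormedAddCommGroup H]
    [InnerProductSpace ℂ H] [CompleteSpace H] [NormedAddCommGroup K] [InnerProductSpace ℂ K]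
    [CompleteSpace K] {X : H →L[ℂ] K} (hX : DenseRange X) : Function.Injective (adjoint X) := by
  rw [injective_iff_map_eq_zero]
  intro y hy
  refine hX.eq_zero_of_inner_left ℂ fun x => ?_
  rw [← adjoint_inner_left, hy, inner_zero_left]

/-- Absorption: the summands with index in the range of `b` can be dropped up to quasisimilarity. The
bijection `e` assigns to the summand `D (b i)` its own infinite set of summands `D (a j)`, those with
`(e j).1 = i`; in each of them it embeds isometrically by `V j`, which intertwines the operators, and
by `V' j`, which intertwines their adjoints. -/
theorem quasiSimilar_absorb [∀ p, CompleteSpace (D p)] (ha : Function.Injective a)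
    (hb : Function.Injective b) (hab : ∀ i j, a i ≠ b j)
    (hcover : ∀ p, (∃ j, a j = p) ∨ ∃ j, b j = p) (T : ∀ p, D p →L[ℂ] D p) (hT : ∀ p, ‖T p‖ ≤ 1)
    (V V' : ∀ j, D (b (e j).1) →ₗᵢ[ℂ] D (a j)) (hV : ∀ j x, V j (T _ x) = T _ (V j x))
    (hV' : ∀ j x, V' j (adjoint (T _) x) = adjoint (T _) (V' j x)) :
    QuasiSimilar (directSum T hT) (directSum (fun j => T (a j)) fun j => hT (a j)) := by
  refine ⟨absorb ha hb V, adjoint (absorb ha hb V'), absorb_injective ha hb hcover V,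
    absorb_denseRange ha hb hab V,
    adjoint_injective_of_denseRange (absorb_denseRange ha hb hab V'),
    denseRange_adjoint (absorb_injective ha hb hcover V'),
    absorb_directSum ha hb V T hV (directSum_apply T hT) (directSum_apply _ _), ?_⟩
  have h := congrArg adjoint (absorb_directSum ha hb V' (fun p => adjoint (T p)) hV'
    (adjoint_directSum_apply T hT) (adjoint_directSum_apply _ fun j => hT (a j)))
  simpa only [adjoint_comp, adjoint_adjoint] using h

end Absorption

end DirectSums

/-! ### Direct sums of Jordan blocks -/

section BlockSums

open ContinuousLinearMap

/-- The direct sum of the Jordan blocks `S(Θᵢ)`. -/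
abbrev blockSum {ι : Type*} (Θ : ι → ℂ → ℂ) :
    lp (fun i => blockSpace (Θ i)) 2 →L[ℂ] lp (fun i => blockSpace (Θ i)) 2 :=
  directSum (fun i => jordanBlock (Θ i)) fun i => norm_jordanBlock_le (Θ i)

theorem QuasiSimilar.trans {H K L : Type*} [NormedAddCommGroup H] [InnerProductSpace ℂ H]
    [NormedAddCommGroup K] [InnerProductSpace ℂ K] [NormedAddCommGroup L] [InnerProductSpace ℂ L]
    {A : H →L[ℂ] H} {B : K →L[ℂ] K} {C : L →L[ℂ] L} (h : QuasiSimilar A B)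
    (h' : QuasiSimilar B C) : QuasiSimilar A C := by
  obtain ⟨X, Y, hXi, hXd, hYi, hYd, hX, hY⟩ := h
  obtain ⟨Z, W, hZi, hZd, hWi, hWd, hZ, hW⟩ := h'
  refine ⟨Z ∘L X, Y ∘L W, hZi.comp hXi, hZd.comp hXd Z.continuous, hYi.comp hWi,
    hYd.comp hWd Y.continuous, ?_, ?_⟩
  · rw [comp_assoc, hX, ← comp_assoc, hZ, comp_assoc]
  · rw [← comp_assoc, hY, comp_assoc, hW, comp_assoc]

/-- Absorption for Jordan blocks: a family of summands `S(φ)` can be dropped, up to quasisimilarity,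
when each of them has its own infinite set of remaining summands `S(θ)` with `φ ∣ θ`. The two embeddings of `ℋ(φ)` in
`ℋ(θ)` are multiplication by `θ / φ` and the inclusion. -/
theorem quasiSimilar_blockSum_absorb {ι ι₂ : Type*} {Φ : ι₂ → ℂ → ℂ} {Ξ : ι → ℂ → ℂ}
    (hΦ : ∀ p, IsInner (Φ p)) {a b : ι → ι₂} (ha : Function.Injective a) (hb : Function.Injective b)
    (hab : ∀ i j, a i ≠ b j) (hcover : ∀ p, (∃ j, a j = p) ∨ ∃ j, b j = p) (e : ι ≃ ι × ℕ)
    (hΞ : (fun j => Φ (a j)) = Ξ) (hdvd : ∀ j, Divides (Φ (b (e j).1)) (Φ (a j))) :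
    QuasiSimilar (blockSum Φ) (blockSum Ξ) := by
  subst hΞ
  choose g hg hmul using hdvd
  have hgi : ∀ j, IsInner (g j) := fun j => (hΦ (a j)).of_mul (hΦ _) (hg j) (hmul j)
  have hmul' : ∀ j, ∀ z ∈ Metric.ball (0 : ℂ) 1, Φ (a j) z = g j z * Φ (b (e j).1) z :=
    fun j z hz => by rw [hmul j z hz, mul_comm]
  exact quasiSimilar_absorb (D := fun p => blockSpace (Φ p)) (e := e) ha hb hab hcover
    (fun p => jordanBlock (Φ p)) (fun p => norm_jordanBlock_le (Φ p))
    (fun j => blockMul (hgi j) (hΦ _) (hmul' j))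
    (fun j => blockIncl ⟨g j, hg j, hmul j⟩)
    (fun j => blockMul_jordanBlock (hgi j) (hΦ _) (hmul' j))
    (fun j => blockIncl_adjoint_jordanBlock ⟨g j, hg j, hmul j⟩)

/-- An intertwining isometry with range `M` yields a quasisimilarity. -/
theorem quasiSimilar_of_isometry {H K : Type*} [NormedAddCommGroup H] [InnerProductSpace ℂ H]
    [NormedAddCommGroup K] [InnerProductSpace ℂ K] {M : Submodule ℂ H} (U : K →ₗᵢ[ℂ] H)
    (hU : ∀ x, U x ∈ M) (hsurj : ∀ y ∈ M, ∃ x, U x = y) {S : M →L[ℂ] M} {S' : K →L[ℂ] K}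
    (h : ∀ x, (S ⟨U x, hU x⟩ : H) = U (S' x)) : QuasiSimilar S S' := by
  let U' : K →ₗᵢ[ℂ] M := ⟨(U : K →ₗ[ℂ] H).codRestrict M hU, fun x => U.norm_map x⟩
  have hU' : Function.Surjective U' := fun ⟨y, hy⟩ => by
    obtain ⟨x, hx⟩ := hsurj y hy
    exact ⟨x, Subtype.ext hx⟩
  let E : K ≃ₗᵢ[ℂ] M := LinearIsometryEquiv.ofSurjective U' hU'
  have hE : ∀ x, S (E x) = E (S' x) := fun x => Subtype.ext (h x)
  refine ⟨E.symm.toContinuousLinearEquiv, E.toContinuousLinearEquiv, E.symm.injective,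
    E.symm.surjective.denseRange, E.injective, E.surjective.denseRange, ?_, ?_⟩
  · ext1 y
    obtain ⟨x, rfl⟩ := E.surjective y
    change E.symm (S (E x)) = S' (E.symm (E x))
    rw [hE, E.symm_apply_apply, E.symm_apply_apply]
  · ext1 x
    exact hE x

variable {ι : Type*} {Θ Φ Ψ : ι → ℂ → ℂ}

/-- The subspace `⨁ (φᵢ H² ⊖ θᵢ H²)` of `⨁ ℋ(θᵢ)`. -/
def factorSubspace (Θ Φ : ι → ℂ → ℂ) : Submodule ℂ (lp (fun i => blockSpace (Θ i)) 2) where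
  carrier := {f | ∀ i, (f i : HardySpace) ∈ (blockSpace (Φ i))ᗮ}
  zero_mem' _ := Submodule.zero_mem _
  add_mem' hf hg i := Submodule.add_mem _ (hf i) (hg i)
  smul_mem' c _ hf i := Submodule.smul_mem _ c (hf i)

theorem isClosed_factorSubspace :
    IsClosed (factorSubspace Θ Φ : Set (lp (fun i => blockSpace (Θ i)) 2)) := by
  have h : (factorSubspace Θ Φ : Set (lp (fun i => blockSpace (Θ i)) 2)) =
      ⋂ i, (fun f => (coord (fun i => blockSpace (Θ i)) i f : HardySpace)) ⁻¹'
        ((blockSpace (Φ i))ᗮ : Set HardySpace) := by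
    ext f
    simp only [Set.mem_iInter]
    rfl
  rw [h]
  exact isClosed_iInter fun i => (Submodule.isClosed_orthogonal _).preimage
    (continuous_subtype_val.comp (coord _ i).continuous)

theorem blockSum_mem_factorSubspace (h : ∀ i, Divides (Φ i) (Θ i))
    {f : lp (fun i => blockSpace (Θ i)) 2} (hf : f ∈ factorSubspace Θ Φ) :
    blockSum Θ f ∈ factorSubspace Θ Φ := fun i => by
  have h1 := shift_mem_orthogonal_blockSpace (hf i)
  have h2 := Submodule.orthogonal_le (h i).blockSpace_le (shift_sub_jordanBlock_mem (f i))
  have h3 := Submodule.sub_mem _ h1 h2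
  rwa [sub_sub_cancel] at h3

/-- For `θᵢ = φᵢ ψᵢ`, the restriction of `⨁ S(θᵢ)` to `⨁ (φᵢ H² ⊖ θᵢ H²)` is unitarily equivalent to
`⨁ S(ψᵢ)`. -/
theorem quasiSimilar_restrict_blockSum (hΦ : ∀ i, IsInner (Φ i)) (hΨ : ∀ i, IsInner (Ψ i))
    (h : ∀ i, ∀ z ∈ Metric.ball (0 : ℂ) 1, Θ i z = Φ i z * Ψ i z)
    (hinv : ∀ f ∈ factorSubspace Θ Φ, blockSum Θ f ∈ factorSubspace Θ Φ) :
    QuasiSimilar (H := factorSubspace Θ Φ) ((blockSum Θ).restrict hinv) (blockSum Ψ) := by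
  refine quasiSimilar_of_isometry (M := factorSubspace Θ Φ)
    (sumIsometry fun i => blockMul (hΦ i) (hΨ i) (h i))
    (fun f i => innerMul_mem_orthogonal_blockSpace (hΦ i) _) (fun g hg => ?_) fun f => ?_
  · refine exists_sumIsometry_eq _ g fun i => ?_
    have hi := hg i
    rw [(hΦ i).orthogonal_blockSpace, mem_innerMultiples_iff (hΦ i).1] at hi
    obtain ⟨q, hq⟩ := hi
    have hq' : innerMul (hΦ i) q ∈ blockSpace (Θ i) := by
      rw [innerMul_apply, hq]
      exact (g i).2
    exact ⟨⟨q, (innerMul_mem_blockSpace_iff (hΦ i) (hΨ i) (h i)).1 hq'⟩, Subtype.ext hq⟩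
  · exact lp.ext (funext fun i => (blockMul_jordanBlock (hΦ i) (hΨ i) (h i) (f i)).symm)

/-- The compression of `⨁ S(θᵢ)` to the orthogonal complement `⨁ ℋ(φᵢ)` of `⨁ (φᵢ H² ⊖ θᵢ H²)` is
unitarily equivalent to `⨁ S(φᵢ)`. -/
theorem quasiSimilar_compression_blockSum (h : ∀ i, Divides (Φ i) (Θ i)) :
    QuasiSimilar (compression (factorSubspace Θ Φ)ᗮ (blockSum Θ)) (blockSum Φ) := by
  classical
  have hmem : ∀ f, sumIsometry (fun i => blockIncl (h i)) f ∈ (factorSubspace Θ Φ)ᗮ := by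
    intro f
    rw [Submodule.mem_orthogonal]
    intro g hg
    rw [lp.inner_eq_tsum]
    have h0 : ∀ i, inner ℂ (g i) (sumIsometry (fun i => blockIncl (h i)) f i) = 0 := fun i =>
      Submodule.inner_left_of_mem_orthogonal (K := blockSpace (Φ i)) (f i).2 (hg i)
    simp [h0]
  refine quasiSimilar_of_isometry (sumIsometry fun i => blockIncl (h i)) hmem
    (fun g hg => ?_) fun f => ?_
  · refine exists_sumIsometry_eq _ g fun i => ⟨blockProj (Φ i) (g i), ?_⟩
    set x : blockSpace (Θ i) := g i - blockIncl (h i) (blockProj (Φ i) (g i)) with hx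
    have hxm : (x : HardySpace) ∈ (blockSpace (Φ i))ᗮ := sub_blockProj_mem (g i : HardySpace)
    have hxs : lp.single 2 i x ∈ factorSubspace Θ Φ := fun j => by
      by_cases hj : j = i
      · subst hj
        rwa [lp.single_apply_self]
      · rw [lp.single_apply_ne _ _ _ hj]
        exact Submodule.zero_mem _
    have h1 : inner ℂ x (g i) = 0 :=
      (lp.inner_single_left (𝕜 := ℂ) i x g).symm.trans (hg _ hxs)
    have h2 : inner ℂ x (blockIncl (h i) (blockProj (Φ i) (g i))) = 0 :=
      Submodule.inner_left_of_mem_orthogonal (K := blockSpace (Φ i)) (blockProj (Φ i) (g i)).2 hxm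
    have h3 : inner ℂ x x = 0 := by
      nth_rewrite 2 [hx]
      rw [inner_sub_right, h1, h2, sub_zero]
    exact (sub_eq_zero.1 (inner_self_eq_zero.1 h3)).symm
  · set U := sumIsometry fun i => blockIncl (h i) with hU
    have hdiff : blockSum Θ (U f) - U (blockSum Φ f) ∈ factorSubspace Θ Φ := fun i => by
      have h1 := Submodule.orthogonal_le (h i).blockSpace_le
        (shift_sub_jordanBlock_mem (blockIncl (h i) (f i)))
      have h2 := shift_sub_jordanBlock_mem (f i)
      have h3 := Submodule.sub_mem _ h2 h1
      rw [coe_blockIncl, sub_sub_sub_cancel_left] at h3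
      exact h3
    have hproj := Submodule.orthogonalProjectionOnto_apply_of_mem_orthogonal
      (K := (factorSubspace Θ Φ)ᗮ) (Submodule.le_orthogonal_orthogonal _ hdiff)
    rw [map_sub, sub_eq_zero] at hproj
    exact (congrArg Subtype.val hproj).trans (congrArg Subtype.val
      (Submodule.orthogonalProjectionOnto_mem_subspace_eq_self ⟨_, hmem (blockSum Φ f)⟩))

end BlockSums

/-! ### Regrouping the index set -/

section Regrouping

/-- A set that is partitioned in infinite classes can be identified with its product by `ℕ`, without
moving any point out of its class. -/
theorem exists_equiv_prod_nat {ι C : Type*} (c : ι → C) (h : ∀ i, Infinite {j // c j = c i}) :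
    ∃ e : ι ≃ ι × ℕ, ∀ j, c (e j).1 = c j := by
  have hg : ∀ y, Nonempty ({j // c j = y} ≃ {j // c j = y} × ℕ) := by
    intro y
    rcases isEmpty_or_nonempty {j // c j = y} with he | ⟨⟨i, rfl⟩⟩
    · exact ⟨Equiv.equivOfIsEmpty _ _⟩
    · have := h i
      refine Cardinal.eq.1 ?_
      rw [Cardinal.mk_prod, Cardinal.lift_uzero, Cardinal.mk_nat, Cardinal.lift_aleph0,
        Cardinal.mul_aleph0_eq (Cardinal.aleph0_le_mk _)]
  let g := fun y => (hg y).some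
  exact ⟨(Equiv.sigmaFiberEquiv c).symm.trans ((Equiv.sigmaCongrRight g).trans
    ((Equiv.sigmaProdDistrib _ _).symm.trans
      ((Equiv.sigmaFiberEquiv c).prodCongr (Equiv.refl ℕ)))),
    fun j => (g (c j) ⟨j, rfl⟩).1.2⟩

/-- Classes of indices: two indices are in the same class if they have the same cardinality or are
both at most countable. -/
def indexClass {κ : Cardinal.{u}} (n : Index κ) : Cardinal.{u} := max n.1.card Cardinal.aleph0

theorem infinite_indexClass {κ : Cardinal.{u}} (hκ : Cardinal.aleph0 ≤ κ) (n : Index κ) :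
    Infinite {m : Index κ // indexClass m = indexClass n} := by
  have hlt : ∀ k : ℕ, n.1 + k < κ.ord := fun k => by
    rw [Cardinal.lt_ord, Ordinal.card_add, Ordinal.card_nat]
    exact Cardinal.add_lt_of_lt hκ (Cardinal.lt_ord.1 n.2.2)
      ((Cardinal.natCast_lt_aleph0).trans_le hκ)
  refine Infinite.of_injective (fun k : ℕ => ⟨⟨n.1 + k,
    n.2.1.trans (le_self_add), hlt k⟩, ?_⟩) fun k l hkl => ?_
  · change max (n.1 + k).card Cardinal.aleph0 = max n.1.card Cardinal.aleph0
    rw [Ordinal.card_add, Ordinal.card_nat]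
    refine le_antisymm (max_le ?_ (le_max_right _ _)) (max_le_max_right _ le_self_add)
    exact Cardinal.add_le_of_le (le_max_right _ _) (le_max_left _ _)
      ((Cardinal.natCast_lt_aleph0).le.trans (le_max_right _ _))
  · have h1 : n.1 + (k : Ordinal) = n.1 + l := congrArg (fun m => m.1.1) hkl
    exact Nat.cast_injective (add_left_cancel h1)

/-- Members of a Jordan family whose indices are in the same class divide each other, when the
members of index at most `ω` agree up to constant factors. -/
theorem IsJordanFamily.divides_of_indexClass_eq {κ : Cardinal.{u}} {θ : Index κ → ℂ → ℂ}
    (hJ : IsJordanFamily θ) (hconst : ∀ m n : Index κ, m.1 = 1 → n.1 ≤ Ordinal.omega0 →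
      Equivalent (θ n) (θ m)) {m n : Index κ} (h : indexClass m = indexClass n) :
    Divides (θ m) (θ n) := by
  let one : Index κ := ⟨1, le_rfl, n.2.1.trans_lt n.2.2⟩
  have hone : ∀ k : Index κ, k.1.card ≤ Cardinal.aleph0 →
      Divides (θ k) (θ one) ∧ Divides (θ one) (θ k) := by
    intro k hk
    rcases le_total k.1 Ordinal.omega0 with hω | hω
    · exact (hconst one k rfl hω).divides
    · let w : Index κ := ⟨Ordinal.omega0, Ordinal.one_lt_omega0.le, hω.trans_lt k.2.2⟩
      have hw : w.1.card = Cardinal.aleph0 := Ordinal.card_omega0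
      have hkw : k.1.card = w.1.card := le_antisymm (hk.trans_eq hw.symm) (Ordinal.card_le_card hω)
      have := (hconst one w rfl le_rfl).divides
      exact ⟨(hJ.divides w k hkw.ge).trans this.1, this.2.trans (hJ.divides k w hkw.le)⟩
  rcases le_or_gt m.1.card Cardinal.aleph0 with hm | hm
  · have hn : n.1.card ≤ Cardinal.aleph0 := by
      have h' : max m.1.card Cardinal.aleph0 = max n.1.card Cardinal.aleph0 := h
      rw [max_eq_right hm] at h'
      exact (le_max_left _ _).trans_eq h'.symm
    exact (hone m hm).1.trans (hone n hn).2
  · refine hJ.divides n m ?_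
    have h' : max m.1.card Cardinal.aleph0 = max n.1.card Cardinal.aleph0 := h
    rw [max_eq_left hm.le] at h'
    rw [h']
    exact le_max_left _ _

end Regrouping

end CZero

end

theorem proposition6p1 (κ : Cardinal.{u}) (hκ : Cardinal.aleph0 ≤ κ)
    (θ θ' θ'' : CZero.Index κ → ℂ → ℂ)
    (hJ : CZero.IsJordanFamily θ) (hJ' : CZero.IsJordanFamily θ') (hJ'' : CZero.IsJordanFamily θ'')
    (hconst : ∀ m n : CZero.Index κ, m.1 = 1 → n.1 ≤ Ordinal.omega0 →
      CZero.Equivalent (θ n) (θ m) ∧ CZero.Equivalent (θ' n) (θ' m) ∧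
        CZero.Equivalent (θ'' n) (θ'' m))
    (hdvd : ∀ n, CZero.Divides (θ' n) (θ n) ∧ CZero.Divides (θ'' n) (θ n))
    (hmul : ∀ n, CZero.Divides (θ n) (fun z => θ' n z * θ'' n z)) :
    ∃ (H : Type (u + 1)) (_ : NormedAddCommGroup H) (_ : InnerProductSpace ℂ H)
      (_ : CompleteSpace H) (T : H →L[ℂ] H) (H' : Submodule ℂ H) (_ : IsClosed (H' : Set H))
      (hinv : ∀ x ∈ H', T x ∈ H'),
      CZero.IsClassC0 T ∧
      CZero.QuasiSimilar T (CZero.jordanOperator θ) ∧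
      CZero.QuasiSimilar (T.restrict hinv) (CZero.jordanOperator θ') ∧
      CZero.QuasiSimilar (CZero.compression H'ᗮ T) (CZero.jordanOperator θ'') := by
  open CZero in
  -- The quotients `α = θ / θ''` and `β = θ / θ'`.
  choose β hβ hθβ using fun n => (hdvd n).1
  choose α hα hθα using fun n => (hdvd n).2
  have hαi : ∀ n, IsInner (α n) := fun n => (hJ.inner n).of_mul (hJ''.inner n) (hα n) (hθα n)
  have hβi : ∀ n, IsInner (β n) := fun n => (hJ.inner n).of_mul (hJ'.inner n) (hβ n) (hθβ n)
  -- Cancelling `θ''` and `θ'`, respectively, from `θ ∣ θ' θ''` gives `α ∣ θ'` and `β ∣ θ''`.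
  have hαθ : ∀ n, Divides (α n) (θ' n) := fun n => by
    obtain ⟨g, hg, h⟩ := hmul n
    refine ⟨g, hg, (hJ''.inner n).mul_left_cancel (hJ'.inner n).1.1 ((hα n).mul hg).1
      fun z hz => ?_⟩
    rw [mul_comm, ← mul_assoc, ← hθα n z hz]
    exact h z hz
  have hβθ : ∀ n, Divides (β n) (θ'' n) := fun n => by
    obtain ⟨g, hg, h⟩ := hmul n
    refine ⟨g, hg, (hJ'.inner n).mul_left_cancel (hJ''.inner n).1.1 ((hβ n).mul hg).1
      fun z hz => ?_⟩
    rw [← mul_assoc, ← hθβ n z hz]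
    exact h z hz
  obtain ⟨e, he⟩ := exists_equiv_prod_nat indexClass (infinite_indexClass hκ)
  let Θ : Index κ ⊕ Index κ → ℂ → ℂ := Sum.elim θ θ
  let Φ : Index κ ⊕ Index κ → ℂ → ℂ := Sum.elim β θ''
  let Ψ : Index κ ⊕ Index κ → ℂ → ℂ := Sum.elim θ' α
  have hΘ : ∀ p, IsInner (Θ p) := fun p => by cases p <;> exact hJ.inner _
  have hΦ : ∀ p, IsInner (Φ p) := fun p => by
    cases p
    exacts [hβi _, hJ''.inner _]
  have hΨ : ∀ p, IsInner (Ψ p) := fun p => by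
    cases p
    exacts [hJ'.inner _, hαi _]
  have hfac : ∀ p, ∀ z ∈ Metric.ball (0 : ℂ) 1, Θ p z = Φ p z * Ψ p z := fun p z hz => by
    cases p
    exacts [(hθβ _ z hz).trans (mul_comm _ _), hθα _ z hz]
  have hΦΘ : ∀ p, Divides (Φ p) (Θ p) := fun p => ⟨Ψ p, (hΨ p).1, hfac p⟩
  have hinv : ∀ f ∈ factorSubspace Θ Φ, blockSum Θ f ∈ factorSubspace Θ Φ := fun f hf =>
    blockSum_mem_factorSubspace hΦΘ hf
  let one : Index κ := ⟨1, le_rfl, by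
    rw [Cardinal.lt_ord, Ordinal.card_one]
    exact Cardinal.one_lt_aleph0.trans_le hκ⟩
  have hone : ∀ n, Divides (θ n) (θ one) := fun n => hJ.divides one n (Ordinal.card_le_card n.2.1)
  have hab : ∀ i j : Index κ, (Sum.inl i : Index κ ⊕ Index κ) ≠ Sum.inr j :=
    fun _ _ => Sum.inl_ne_inr
  have hcover : ∀ p : Index κ ⊕ Index κ, (∃ j, Sum.inl j = p) ∨ ∃ j, Sum.inr j = p := fun p => by
    cases p <;> simp
  have hT : QuasiSimilar (blockSum Θ) (blockSum θ) :=
    quasiSimilar_blockSum_absorb hΘ Sum.inl_injective Sum.inr_injective hab hcover e rfl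
      fun j => hJ.divides_of_indexClass_eq (fun m n hm hn => (hconst m n hm hn).1) (he j)
  have hΨ' : QuasiSimilar (blockSum Ψ) (blockSum θ') :=
    quasiSimilar_blockSum_absorb hΨ Sum.inl_injective Sum.inr_injective hab hcover e rfl
      fun j => (hαθ _).trans (hJ'.divides_of_indexClass_eq
        (fun m n hm hn => (hconst m n hm hn).2.1) (he j))
  have hΦ' : QuasiSimilar (blockSum Φ) (blockSum θ'') :=
    quasiSimilar_blockSum_absorb hΦ Sum.inr_injective Sum.inl_injective
      (fun i j => (hab j i).symm) (fun p => (hcover p).symm) e rfl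
      fun j => (hβθ _).trans (hJ''.divides_of_indexClass_eq
        (fun m n hm hn => (hconst m n hm hn).2.2) (he j))
  have hC0 : IsClassC0 (blockSum Θ) :=
    isClassC0_directSum Θ (hJ.inner one).1 (hJ.inner one).exists_ne_zero fun p => by
      cases p <;> exact hone _
  have hR : QuasiSimilar (H := factorSubspace Θ Φ) ((blockSum Θ).restrict hinv)
      (jordanOperator θ') := (quasiSimilar_restrict_blockSum hΦ hΨ hfac hinv).trans hΨ'
  have hC : QuasiSimilar (compression (factorSubspace Θ Φ)ᗮ (blockSum Θ)) (jordanOperator θ'') :=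
    (quasiSimilar_compression_blockSum hΦΘ).trans hΦ'
  exact ⟨_, _, _, inferInstance, blockSum Θ, factorSubspace Θ Φ, isClosed_factorSubspace,
    hinv, hC0, hT, hR, hC⟩
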